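/- Let $Q(x,y)=ax^2+hxy+by^2$ be an indefinite integer binary quadratic form not representing zero, i.e. $Q(x,y)\ne 0$ for $(x,y)\in\mathbb Z^2\setminus\{(0,0)\}$. **The tree.** The vertices of the binary planar tree are the superbases: triples $\{\pm e_1,\pm e_2,\pm e_3\}$ with $(e_1,e_2)$ a basis of $\mathbb Z^2$ and $e_1+e_2+e_3=0$. Two superbases are joined by an edge when they share exactly two of the pairs $\pm e_i$; these two pairs are the faces on the two sides of the edge, and the face $\pm(x,y)$ is labelled by the fraction $x/y$. Let $V_Q=\{\pm(1,0),\pm(0,1),\pm(1,1)\}$. The Conway river of $Q$ consists of the edges separating a face with a positive value of $Q$ from a face with a negative value. For non-negative integers $c_0,c_1,\dots$ the path $[c_0,c_1,\dots]$ starts at $V_Q$ and makes $c_0$ left turns, then $c_1$ right turns, then $c_2$ left turns, and so on: after $n$ turns it is at the superbase $\{\pm Ae_1,\pm Ae_2,\pm A(e_1+e_2)\}$, where $e_1=(1,0)$, $e_2=(0,1)$ and $A$ is the product of the first $n$ factors of $L^{c_0}R^{c_1}L^{c_2}\cdots$, with $L=\begin{pmatrix}1&1\\0&1\end{pmatrix}$,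 $R=\begin{pmatrix}1&0\\1&1\end{pmatrix}$. The path $-[c_0,c_1,\dots]$ goes from $V_Q$ across the edge between $1/0$ and $0/1$ and then follows the reflection, under $(x,y)\mapsto(-x,y)$, of the path $[c_0,c_1,\dots]$. Zeros are allowed in paths and in continued fractions. An infinite path leads to $\xi$ if the fractions of the faces at its vertices tend to $\xi$. All paths asserted to exist or to be unique are without repeated vertices. **The expansion.** Let $\alpha,\bar\alpha$ be the two real roots of $a\xi^2+h\xi+b=0$, where $\alpha$ is a root of maximal modulus, and suppose that $\alpha>0$. Then $\alpha$ has a periodic continued fraction expansion, which is either pure periodic, $\alpha=[\overline{b_1,\dots,b_l}]$, or can be written as $$\alpha=[a_0,\dots,a_k,\overline{b_1,\dots,b_l}]\quad\text{with }k\ge 0,\ a_k\ne b_l .$$ For every such expansion the following holds (indices of the $b_i$ in the period are read modulo $l$). 1. The expansion of $\alpha$, as a path, is the unique path $\gamma_\alpha$ from $V_Q$ leading to $\alpha$. It goes from $V_Q$ to the Conway river, and from its first vertex on the river on, all its edges belong to the river. 2. The Conway river is a path, infinite in both directions, leading to $\bar\alpha$ in one direction and to $\alpha$ in the other. Its turns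 are described by the bi-infinite repetition of the period $b_1,\dots,b_l$: blocks of equal turns of these lengths, alternately left and right. From the end of the preperiod $a_0,\dots,a_k$ (from $V_Q$, if the preperiod is empty) the path $\gamma_\alpha$ follows the river, starting with the block $b_1$. 3. There is a unique path $\pi$ from $V_Q$ to the first vertex on the river (the path without edges, denoted $\emptyset$, if $V_Q$ is on the river). It is $$\pi=\begin{cases}[a_0,\dots,a_{k-1},a_k-b_l-1]&\text{if }k\ge1,\ a_k>b_l,\\ [a_0,\dots,a_{k-2},a_{k-1}-1]&\text{if }k\ge1,\ a_k<b_l,\end{cases}\qquad \pi=\begin{cases}[a_0-b_l-1]&\text{if }k=0,\ a_0>b_l,\\ \emptyset&\text{if }k=0,\ a_0<b_l,\end{cases}$$ and $\pi=\emptyset$ if the expansion is pure periodic. The exceptional case $k\ge1$, $a_k<b_l$, $a_{k-1}=0$ is possible only for $k=1$, $a_0=0$, $ab<0$, and then $\pi=\emptyset$. 4. There is likewise a unique path $\gamma_{\bar\alpha}$ from $V_Q$ leading to $\bar\alpha$; it goes to the river and then stays on it, and it is the path described by the following expansion of $\bar\alpha$: - $\bar\alpha=[a_0,\dots,a_{k-1},a_k-b_l-1,1,b_{l-1}-1,\overline{b_{l-2},b_{l-3},\dots,b_1,b_l,b_{l-1}}]$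 if $k\ge0$, $a_k>b_l$; - $\bar\alpha=[a_0,\dots,a_{k-1}-1,1,b_l-a_k-1,\overline{b_{l-1},\dots,b_1,b_l}]$ if $k\ge1$, $a_k<b_l$, $a_{k-1}\ge1$; - $\bar\alpha=-[0,b_l-a_1,\overline{b_{l-1},\dots,b_1,b_l}]$ if $k=1$, $a_0=0$, $a_1<b_l$; - $\bar\alpha=-[b_l-a_0,\overline{b_{l-1},\dots,b_1,b_l}]$ if $k=0$, $a_0<b_l$; - $\bar\alpha=-[0,\overline{b_l,\dots,b_1}]$ if the expansion of $\alpha$ is pure periodic. -/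

import Mathlib

noncomputable section

namespace ConwayTopograph

open Filter Topology Matrix.SpecialLinearGroup
open scoped MatrixGroups

/-! ### Binary quadratic forms -/

/-- The value of the integer binary quadratic form `a x² + h x y + b y²` at `(x, y)`. -/
def form (a h b : ℤ) (v : ℤ × ℤ) : ℤ := a * v.1 ^ 2 + h * v.1 * v.2 + b * v.2 ^ 2

/-- The form takes both positive and negative values. -/
def Indefinite (a h b : ℤ) : Prop := (∃ v, 0 < form a h b v) ∧ ∃ v, form a h b v < 0

/-- The form does not represent zero. -/
def NotRepresentingZero (a h b : ℤ) : Prop := ∀ v : ℤ × ℤ, v ≠ 0 → form a h b v ≠ 0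

/-! ### The tree of superbases -/

/-- The lax vector `±v`, as the unordered pair of `v` and `-v`. -/
def lax (v : ℤ × ℤ) : Sym2 (ℤ × ℤ) := s(v, -v)

/-- `(u, v)` is a basis of the lattice `ℤ²`. -/
def IsLatticeBasis (u v : ℤ × ℤ) : Prop := IsUnit (u.1 * v.2 - u.2 * v.1)

/-- A superbase: a triple of lax vectors `±e₁, ±e₂, ±e₃` where `(e₁, e₂)` is a basis of `ℤ²` and
`e₁ + e₂ + e₃ = 0`. -/
def Superbase : Type :=
  {S : Finset (Sym2 (ℤ × ℤ)) // ∃ e₁ e₂ e₃ : ℤ × ℤ,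
    IsLatticeBasis e₁ e₂ ∧ e₁ + e₂ + e₃ = 0 ∧ S = {lax e₁, lax e₂, lax e₃}}

/-- The superbase `±u, ±v, ±(u + v)`. -/
def Superbase.ofBasis (u v : ℤ × ℤ) (huv : IsLatticeBasis u v) : Superbase :=
  ⟨{lax u, lax v, lax (-(u + v))}, u, v, -(u + v), huv, by abel, rfl⟩

/-- The binary planar tree: its vertices are the superbases, and two superbases are joined by an
edge when they have exactly two lax vectors (the faces on the two sides of the edge) in common. -/
def topograph : SimpleGraph Superbase where
  Adj S T := S ≠ T ∧ (S.1 ∩ T.1).card = 2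
  symm := ⟨fun S T hST => ⟨hST.1.symm, by rw [Finset.inter_comm]; exact hST.2⟩⟩
  loopless := ⟨fun _ hS => hS.1 rfl⟩

/-- The Conway river of the form: it consists of the edges of the tree that separate a face with a
positive value of the form from a face with a negative value. -/
def river (a h b : ℤ) : SimpleGraph Superbase where
  Adj S T := topograph.Adj S T ∧ ∃ u v : ℤ × ℤ, lax u ∈ S.1 ∩ T.1 ∧ lax v ∈ S.1 ∩ T.1 ∧
    0 < form a h b u ∧ form a h b v < 0
  symm := ⟨fun S T hST => ⟨hST.1.symm, by rw [Finset.inter_comm]; exact hST.2⟩⟩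
  loopless := ⟨fun _ hS => hS.1.1 rfl⟩

/-- The vertex at the end of the oriented edge with matrix `M`: the two columns of `M` are the
faces adjacent to the edge, and the vertex is the superbase that contains also their sum. -/
def vertex (M : SL(2, ℤ)) : Superbase :=
  Superbase.ofBasis (M 0 0, M 1 0) (M 0 1, M 1 1) (by
    have h := M.det_coe
    rw [Matrix.det_fin_two] at h
    have h' : M 0 0 * M 1 1 - M 1 0 * M 0 1 = 1 := by linarith
    unfold IsLatticeBasis
    simp only [h', isUnit_one])

/-- The image of `vertex M` under the reflection `(x, y) ↦ (-x, y)`, that is `ξ ↦ -ξ` on the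
fractions `ξ = x / y`. -/
def reflectedVertex (M : SL(2, ℤ)) : Superbase :=
  Superbase.ofBasis (-M 0 0, M 1 0) (-M 0 1, M 1 1) (by
    have h := M.det_coe
    rw [Matrix.det_fin_two] at h
    have h' : -M 0 0 * M 1 1 - M 1 0 * -M 0 1 = -1 := by linarith
    unfold IsLatticeBasis
    simp only [h']
    exact isUnit_one.neg)

/-- The initial vertex, with the faces `1/0`, `0/1` and `1/1`. -/
def initialVertex : Superbase := vertex 1

/-! ### Continued fractions and the paths that they describe -/

/-- The infinite continued fraction `[c 0, c 1, c 2, …]`. -/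
def contFrac (c : ℕ → ℕ) : GenContFract ℝ :=
  ⟨(c 0 : ℝ), Stream'.Seq.ofStream fun n => ⟨1, (c (n + 1) : ℝ)⟩⟩

/-- `ξ = [c 0, c 1, c 2, …]`: the convergents tend to `ξ`. Zeros are allowed among the `c i`. -/
def HasContFrac (c : ℕ → ℕ) (ξ : ℝ) : Prop := Tendsto (contFrac c).convs atTop (𝓝 ξ)

/-- The sequence `pre, per, per, per, …`. -/
def periodicSeq (pre per : List ℕ) (n : ℕ) : ℕ :=
  if n < pre.length then pre.getD n 0 else per.getD ((n - pre.length) % per.length) 0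

/-- `ξ = [a₀, …, aₖ, b₁, …, bₗ, b₁, …, bₗ, …]` is the continued fraction expansion of `ξ`, with
preperiod `pre = a₀, …, aₖ` and period `per = b₁, …, bₗ`, written so that `aₖ ≠ bₗ`. The preperiod
is empty for a pure periodic expansion. -/
def IsPeriodicExpansion (pre per : List ℕ) (ξ : ℝ) : Prop :=
  per ≠ [] ∧ (∀ x ∈ per, 1 ≤ x) ∧ (∀ x ∈ pre.tail, 1 ≤ x) ∧ pre.getLast? ≠ per.getLast? ∧
    HasContFrac (periodicSeq pre per) ξ

/-- A turn of a path in the planar tree. -/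
inductive Turn : Type
  | left
  | right

/-- The opposite turn. -/
def Turn.flip : Turn → Turn
  | .left => .right
  | .right => .left

/-- The matrix by which a turn acts, from the right, on the matrices of the oriented edges:
`L = (1 1; 0 1)` for a left turn and `R = (1 0; 1 1)` for a right turn. -/
def Turn.mat : Turn → SL(2, ℤ)
  | .left => ⟨!![1, 1; 0, 1], by simp [Matrix.det_fin_two]⟩
  | .right => ⟨!![1, 0; 1, 1], by simp [Matrix.det_fin_two]⟩

/-- The turn in the `j`-th block: left in the even and right in the odd blocks. -/
def blockTurn (j : ℕ) : Turn := if Even j then .left else .right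

/-- The `n`-th turn of the path with `c 0` left turns, then `c 1` right turns, then `c 2` left
turns, and so on: it belongs to the first block `j` with `n < c 0 + ⋯ + c j`. -/
def turnOf (c : ℕ → ℕ) (n : ℕ) : Turn :=
  blockTurn (sInf {j : ℕ | n < ∑ i ∈ Finset.range (j + 1), c i})

/-- The matrix `L ^ c 0 * R ^ c 1 * L ^ c 2 * ⋯` after the first `n` turns. -/
def pathMatrix (c : ℕ → ℕ) : ℕ → SL(2, ℤ)
  | 0 => 1
  | n + 1 => pathMatrix c n * (turnOf c n).mat

/-- The path from the initial vertex described by the continued fraction `[c 0, c 1, c 2, …]`. -/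
def path (c : ℕ → ℕ) (n : ℕ) : Superbase := vertex (pathMatrix c n)

/-- The path from the initial vertex described by the negative continued fraction
`-[c 0, c 1, c 2, …]`: it crosses the edge between `1/0` and `0/1`, and then follows the reflection
of the path of `[c 0, c 1, c 2, …]`. -/
def negPath (c : ℕ → ℕ) : ℕ → Superbase
  | 0 => initialVertex
  | n + 1 => reflectedVertex (pathMatrix c n)

/-! ### Properties of paths -/

/-- Along the filter `f` the fractions `x / y` of the faces at the vertices `γ n` tend to `ξ`. -/
def LeadsTo {ι : Type} (γ : ι → Superbase) (f : Filter ι) (ξ : ℝ) : Prop :=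
  ∀ ε : ℝ, 0 < ε → ∀ᶠ n in f, ∀ v : ℤ × ℤ, lax v ∈ (γ n).1 →
    v.2 ≠ 0 ∧ |(v.1 : ℝ) / (v.2 : ℝ) - ξ| < ε

/-- `γ` is an infinite path without repetitions from the initial vertex to the end `ξ`. -/
def IsRayTo (γ : ℕ → Superbase) (ξ : ℝ) : Prop :=
  γ 0 = initialVertex ∧ (∀ n, topograph.Adj (γ n) (γ (n + 1))) ∧ Function.Injective γ ∧
    LeadsTo γ atTop ξ

/-- `γ` is the only path without repetitions from the initial vertex to the end `ξ`. -/
def IsUniqueRayTo (γ : ℕ → Superbase) (ξ : ℝ) : Prop :=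
  IsRayTo γ ξ ∧ ∀ γ', IsRayTo γ' ξ → γ' = γ

/-- `γ` goes to the river, and then stays on the river forever. -/
def GoesToRiver (a h b : ℤ) (γ : ℕ → Superbase) : Prop :=
  ∃ N, (∀ n < N, γ n ∉ (river a h b).support) ∧ ∀ n ≥ N, (river a h b).Adj (γ n) (γ (n + 1))

/-- `[c 0, c 1, …]` is an expansion of `ξ`, and it describes the unique path from the initial
vertex to the river and then along the river towards `ξ`. -/
def Describes (a h b : ℤ) (c : ℕ → ℕ) (ξ : ℝ) : Prop :=
  HasContFrac c ξ ∧ IsUniqueRayTo (path c) ξ ∧ GoesToRiver a h b (path c)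

/-- `-[c 0, c 1, …]` is an expansion of `ξ`, and it describes the unique path from the initial
vertex to the river and then along the river towards `ξ`. -/
def NegDescribes (a h b : ℤ) (c : ℕ → ℕ) (ξ : ℝ) : Prop :=
  HasContFrac c (-ξ) ∧ IsUniqueRayTo (negPath c) ξ ∧ GoesToRiver a h b (negPath c)

/-- `p` is a path from the initial vertex to the river: its end is its only vertex on the river. -/
def IsApproach (a h b : ℤ) {S : Superbase} (p : topograph.Walk initialVertex S) : Prop :=
  p.IsPath ∧ S ∈ (river a h b).support ∧ ∀ T ∈ p.support, T ∈ (river a h b).support → T = S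

/-- `p` is the finite path described by `[w₀, …, wᵣ]`, which has `w₀ + ⋯ + wᵣ` turns: `w₀` left
turns, then `w₁` right turns, and so on. -/
def Follows (w : List ℕ) {S : Superbase} (p : topograph.Walk initialVertex S) : Prop :=
  p.length = w.sum ∧ ∀ n ≤ w.sum, p.getVert n = path (fun i => w.getD i 0) n

/-- There is exactly one path from the initial vertex to the river, and it is `[w₀, …, wᵣ]`. -/
def ApproachIs (a h b : ℤ) (w : List ℕ) : Prop :=
  (∃ (S : Superbase) (p : topograph.Walk initialVertex S), IsApproach a h b p ∧ Follows w p) ∧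
    ∀ (S : Superbase) (p : topograph.Walk initialVertex S), IsApproach a h b p → Follows w p

/-- The turns `τ` of a bi-infinite path are described by the bi-infinite repetition of `per`: the
turns with numbers from `s j` to `s (j + 1) - 1` form the `j`-th block, which has the length given
by the period; the turns are equal within a block and change from one block to the next. The
blocks start at the turn with number `0`, with the turn `first`. -/
def BiPeriodicTurns (per : List ℕ) (first : Turn) (τ : ℤ → Turn) : Prop :=
  ∃ s : ℤ → ℤ, s 0 = 0 ∧
    (∀ j, s (j + 1) = s j + (per.getD (j % (per.length : ℤ)).toNat 0 : ℕ)) ∧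
    ∀ j n, s j ≤ n → n < s (j + 1) → τ n = if Even j then first else first.flip

/-- The river is an infinite in both directions path `ρ` from `ξ'` to `ξ`, whose turns are described
by the bi-infinite repetition of `per`; the edge `B 0` with which a period starts is the one at the
end of the preperiod of `[pre, per, per, …]`, so that the path of this continued fraction follows
the river from there on. -/
def RiverIs (a h b : ℤ) (pre per : List ℕ) (ξ' ξ : ℝ) : Prop :=
  ∃ (B : ℤ → SL(2, ℤ)) (τ : ℤ → Turn),
    BiPeriodicTurns per (blockTurn pre.length) τ ∧
    (∀ n, B (n + 1) = B n * (τ n).mat) ∧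
    (∀ n : ℕ, B n = pathMatrix (periodicSeq pre per) (pre.sum + n)) ∧
    Function.Injective (fun n => vertex (B n)) ∧
    (∀ S T, (river a h b).Adj S T ↔
      ∃ n, (S = vertex (B n) ∧ T = vertex (B (n + 1))) ∨
        (T = vertex (B n) ∧ S = vertex (B (n + 1)))) ∧
    LeadsTo (fun n => vertex (B n)) atTop ξ ∧ LeadsTo (fun n => vertex (B n)) atBot ξ'

end ConwayTopograph

end

open ConwayTopograph

noncomputable section

namespace ConwayTopograph

open Filter Topology Matrix.SpecialLinearGroup
open scoped MatrixGroups

/-! ### The action of `SL(2, ℤ)` on the tree -/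

/-! An oriented edge is a matrix in `SL(2, ℤ)`: left multiplication moves the whole tree, right
multiplication by a turn or by `reverseMat` walks in it. For an irrational ξ put λ(x, y) = x - ξ y.
An edge points to ξ if λ has opposite signs on its two faces, and `weight`, the sum of |λ| over the
faces of a vertex, drops exactly along pointing edges. Each vertex has exactly one descending edge
(`exists_toward`, `Toward.unique`), so the paths to ξ are the orbits of a flow (`leadsTo_of_toward`,
`toward_of_leadsTo`). All uniqueness of paths comes from this flow; no separate proof that the graph
has no cycles is needed.

The form is a times the product of the two linear forms of its roots, so an edge lies on the river
exactly when it points to one root and not to the other (`ConjugateRoots.river_adj_iff`). The paths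
to the two roots therefore run together until they part, and the parting vertex is the first one on
the river (`ConjugateRoots.approachIs`).

Continued fractions enter through `quot`: a turn subtracts 1 and a change of side inverts, so the
complete quotients of an expansion of ξ are the values of `quot` at the block starts. An expansion
with positive complete quotients is thus the same as a path towards ξ (`HasQuotients.points`,
`hasQuotients_of_points`).

If β is the purely periodic tail of α, Galois' theorem (`exists_periodic_part`) says that its
conjugate β' is negative and that -1/β' has the reversed period. Carrying β' back through the
preperiod gives the expansions of the conjugate root (`hasQuotients_of_gt`, `hasQuotients_of_lt`,
`hasQuotients_neg_of_lt`); comparing them with that of α shows where the paths part. The same signs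
β > 0 > β' show that the bi-infinite repetition of the period is the river
(`ConjugateRoots.riverIs`). Existence of the expansion is Lagrange's theorem: there are only
finitely many forms of given discriminant whose outer coefficients have opposite signs. -/

/-- The quarter turn, which reverses the orientation of an edge. -/
def reverseMat : SL(2, ℤ) := ⟨!![0, -1; 1, 0], by simp [Matrix.det_fin_two]⟩

/-- The product of a matrix and a column vector. -/
def act (M : SL(2, ℤ)) (w : ℤ × ℤ) : ℤ × ℤ :=
  (M 0 0 * w.1 + M 0 1 * w.2, M 1 0 * w.1 + M 1 1 * w.2)

lemma det_eq (M : SL(2, ℤ)) : M 0 0 * M 1 1 - M 0 1 * M 1 0 = 1 := by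
  have h := M.det_coe
  rwa [Matrix.det_fin_two] at h

lemma mul_entry (M A : SL(2, ℤ)) (i j : Fin 2) :
    (M * A) i j = M i 0 * A 0 j + M i 1 * A 1 j := by
  simp [Matrix.mul_apply, Fin.sum_univ_two]

lemma act_mul (M A : SL(2, ℤ)) (w : ℤ × ℤ) : act (M * A) w = act M (act A w) := by
  simp only [act, mul_entry]
  ext <;> simp <;> ring

lemma act_one (w : ℤ × ℤ) : act 1 w = w := by
  simp [act]

lemma act_neg (M : SL(2, ℤ)) (w : ℤ × ℤ) : act M (-w) = -act M w := by
  ext <;> simp [act] <;> ring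

lemma act_add (M : SL(2, ℤ)) (v w : ℤ × ℤ) : act M (v + w) = act M v + act M w := by
  ext <;> simp [act] <;> ring

lemma act_injective (M : SL(2, ℤ)) : Function.Injective (act M) := by
  intro v w hvw
  have := congrArg (act M⁻¹) hvw
  rwa [← act_mul, ← act_mul, inv_mul_cancel, act_one, act_one] at this

lemma act_eq_zero {M : SL(2, ℤ)} {w : ℤ × ℤ} : act M w = 0 ↔ w = 0 := by
  constructor
  · intro h
    apply act_injective M
    rw [h]
    simp [act, Prod.ext_iff]
  · rintro rfl
    simp [act]

lemma lax_eq_lax {v w : ℤ × ℤ} : lax v = lax w ↔ v = w ∨ v = -w := by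
  simp only [lax, Sym2.eq_iff]
  constructor
  · rintro (⟨h, -⟩ | ⟨h, -⟩)
    · exact Or.inl h
    · exact Or.inr h
  · rintro (rfl | rfl)
    · simp
    · simp

lemma lax_neg (v : ℤ × ℤ) : lax (-v) = lax v := lax_eq_lax.2 (Or.inr rfl)

lemma map_act_lax (M : SL(2, ℤ)) (w : ℤ × ℤ) : Sym2.map (act M) (lax w) = lax (act M w) := by
  simp [lax, act_neg]

lemma lax_act_eq {M : SL(2, ℤ)} {v w : ℤ × ℤ} : lax (act M v) = lax (act M w) ↔ lax v = lax w := by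
  rw [← map_act_lax, ← map_act_lax, (Sym2.map.injective (act_injective M)).eq_iff]

lemma vertex_faces (M : SL(2, ℤ)) :
    (vertex M).1 = {lax (act M (1, 0)), lax (act M (0, 1)), lax (act M (1, 1))} := by
  have h : -((M 0 0, M 1 0) + (M 0 1, M 1 1)) = -act M (1, 1) := by
    ext <;> simp [act]
  simp only [vertex, Superbase.ofBasis]
  rw [h, lax_neg]
  simp [act]

lemma mem_vertex {M : SL(2, ℤ)} {l : Sym2 (ℤ × ℤ)} : l ∈ (vertex M).1 ↔
    l = lax (act M (1, 0)) ∨ l = lax (act M (0, 1)) ∨ l = lax (act M (1, 1)) := by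
  simp [vertex_faces]

lemma lax_fst_ne_snd : lax (1, 0) ≠ lax (0, 1) := by rw [Ne, lax_eq_lax]; decide
lemma lax_fst_ne_sum : lax (1, 0) ≠ lax (1, 1) := by rw [Ne, lax_eq_lax]; decide
lemma lax_snd_ne_sum : lax (0, 1) ≠ lax (1, 1) := by rw [Ne, lax_eq_lax]; decide

/-- Left multiplication is a change of basis of the lattice and acts on the whole tree. Incidence
questions at `M` can thereby be moved to the identity, as in `adj_reverse`. -/
lemma vertex_mul_faces (M A : SL(2, ℤ)) :
    (vertex (M * A)).1 = (vertex A).1.image (Sym2.map (act M)) := by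
  simp [vertex_faces, Finset.image_insert, map_act_lax, act_mul]

lemma vertex_mul_eq_iff {M A A' : SL(2, ℤ)} :
    vertex (M * A) = vertex (M * A') ↔ vertex A = vertex A' := by
  constructor
  · intro h
    have h' := congrArg Subtype.val h
    rw [vertex_mul_faces, vertex_mul_faces] at h'
    exact Subtype.ext (Finset.image_injective (Sym2.map.injective (act_injective M)) h')
  · intro h
    apply Subtype.ext
    rw [vertex_mul_faces, vertex_mul_faces, h]

lemma adj_vertex_mul_iff {M A A' : SL(2, ℤ)} :
    topograph.Adj (vertex (M * A)) (vertex (M * A')) ↔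
      topograph.Adj (vertex A) (vertex A') := by
  have hinj : Function.Injective (Sym2.map (act M)) := Sym2.map.injective (act_injective M)
  simp only [topograph, Ne, vertex_mul_eq_iff, vertex_mul_faces]
  rw [← Finset.image_inter _ _ hinj, Finset.card_image_of_injective _ hinj]

lemma exists_vertex_eq (S : Superbase) : ∃ M, S = vertex M := by
  obtain ⟨S, e₁, e₂, e₃, hb, hsum, rfl⟩ := S
  have he : e₃ = -(e₁ + e₂) := by rw [← add_eq_zero_iff_neg_eq.1 hsum]
  subst he
  rcases Int.isUnit_iff.1 hb with h | h
  · refine ⟨⟨!![e₁.1, e₂.1; e₁.2, e₂.2], by rw [Matrix.det_fin_two]; simp; linarith⟩, ?_⟩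
    apply Subtype.ext
    simp [vertex, Superbase.ofBasis]
  -- Exchanging the two vectors turns determinant -1 into 1; the superbase does not depend on their
  -- order.
  · refine ⟨⟨!![e₂.1, e₁.1; e₂.2, e₁.2], by rw [Matrix.det_fin_two]; simp; linarith⟩, ?_⟩
    apply Subtype.ext
    simp only [add_comm e₁ e₂]
    rw [Finset.insert_comm]
    simp [vertex, Superbase.ofBasis]

lemma vertex_reverse_faces (M : SL(2, ℤ)) : (vertex (M * reverseMat)).1 =
    {lax (act M (1, 0)), lax (act M (0, 1)), lax (act M (1, -1))} := by
  have h : (vertex reverseMat).1 = {lax (1, 0), lax (0, 1), lax (1, -1)} := by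
    rw [vertex_faces, Finset.insert_comm]
    have h1 : act reverseMat (0, 1) = -(1, 0) := by simp [act, reverseMat]
    have h2 : act reverseMat (1, 0) = (0, 1) := by simp [act, reverseMat]
    have h3 : act reverseMat (1, 1) = -(1, -1) := by simp [act, reverseMat]
    rw [h1, h2, h3, lax_neg, lax_neg]
  rw [vertex_mul_faces, h]
  simp [Finset.image_insert, map_act_lax]

lemma act_left (w : ℤ × ℤ) : act Turn.left.mat w = (w.1 + w.2, w.2) := by
  simp [act, Turn.mat]

lemma act_right (w : ℤ × ℤ) : act Turn.right.mat w = (w.1, w.1 + w.2) := by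
  simp [act, Turn.mat]

lemma vertex_left_faces (M : SL(2, ℤ)) : (vertex (M * Turn.left.mat)).1 =
    {lax (act M (1, 0)), lax (act M (1, 1)), lax (act M (2, 1))} := by
  simp only [vertex_faces, act_mul, act_left]
  norm_num

lemma vertex_right_faces (M : SL(2, ℤ)) : (vertex (M * Turn.right.mat)).1 =
    {lax (act M (1, 1)), lax (act M (0, 1)), lax (act M (1, 2))} := by
  simp only [vertex_faces, act_mul, act_right]
  norm_num

/-- The square of `reverseMat` is -1, and signs are invisible in lax vectors. -/
lemma vertex_mul_reverse_reverse (M : SL(2, ℤ)) :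
    vertex (M * reverseMat * reverseMat) = vertex M := by
  apply Subtype.ext
  rw [vertex_reverse_faces, vertex_faces]
  have h1 : act (M * reverseMat) (1, 0) = act M (0, 1) := by simp [act_mul]; simp [act, reverseMat]
  have h2 : act (M * reverseMat) (0, 1) = -act M (1, 0) := by
    rw [act_mul, ← act_neg]; simp [act, reverseMat]
  have h3 : act (M * reverseMat) (1, -1) = act M (1, 1) := by
    rw [act_mul]; simp [act, reverseMat]
  rw [h1, h2, h3, lax_neg, Finset.insert_comm]

/-- A turn gives the matrix of an edge leaving the vertex of `M`; this converts facts about edges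
into facts about turns. -/
lemma vertex_mul_turn_reverse (M : SL(2, ℤ)) (t : Turn) :
    vertex (M * t.mat * reverseMat) = vertex M := by
  apply Subtype.ext
  rw [vertex_reverse_faces, vertex_faces]
  cases t
  · have h1 : act (M * Turn.left.mat) (1, 0) = act M (1, 0) := by
      rw [act_mul]; simp [act, Turn.mat]
    have h2 : act (M * Turn.left.mat) (0, 1) = act M (1, 1) := by
      rw [act_mul]; simp [act, Turn.mat]
    have h3 : act (M * Turn.left.mat) (1, -1) = -act M (0, 1) := by
      rw [act_mul, ← act_neg]; simp [act, Turn.mat]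
    rw [h1, h2, h3, lax_neg]
    ext; simp; tauto
  · have h1 : act (M * Turn.right.mat) (1, 0) = act M (1, 1) := by
      rw [act_mul]; simp [act, Turn.mat]
    have h2 : act (M * Turn.right.mat) (0, 1) = act M (0, 1) := by
      rw [act_mul]; simp [act, Turn.mat]
    have h3 : act (M * Turn.right.mat) (1, -1) = act M (1, 0) := by
      rw [act_mul]; simp [act, Turn.mat]
    rw [h1, h2, h3]
    ext; simp; tauto

lemma adj_reverse (M : SL(2, ℤ)) : topograph.Adj (vertex (M * reverseMat)) (vertex M) := by
  have h : topograph.Adj (vertex reverseMat) (vertex 1) := by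
    have h1 := vertex_reverse_faces 1
    rw [one_mul] at h1
    simp only [act_one] at h1
    have h2 := vertex_faces 1
    simp only [act_one] at h2
    refine ⟨fun h => ?_, ?_⟩
    · have h' := congrArg Subtype.val h
      rw [h1, h2] at h'
      revert h'
      simp only [lax]
      decide
    · rw [h1, h2]
      simp only [lax]
      decide
  rw [← adj_vertex_mul_iff (M := M), mul_one] at h
  exact h

lemma adj_turn (M : SL(2, ℤ)) (t : Turn) : topograph.Adj (vertex M) (vertex (M * t.mat)) := by
  have := adj_reverse (M * t.mat)
  rwa [vertex_mul_turn_reverse] at this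

lemma triple_rotate {α : Type*} [DecidableEq α] (x y z : α) :
    ({x, y, z} : Finset α) = {y, z, x} := by
  ext; simp; tauto

/-- Two faces of a superbase determine the third one up to the choice between two. -/
lemma faces_of_mem {T : Superbase} {f g : ℤ × ℤ} (hf : lax f ∈ T.1) (hg : lax g ∈ T.1)
    (hfg : lax f ≠ lax g) :
    T.1 = {lax f, lax g, lax (f + g)} ∨ T.1 = {lax f, lax g, lax (f - g)} := by
  obtain ⟨e₁, e₂, e₃, -, hsum, hT⟩ := T.2
  rw [hT] at hf hg ⊢
  clear hT
  have he : e₃ = -(e₁ + e₂) := by rw [← add_eq_zero_iff_neg_eq.1 hsum]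
  subst he
  have key : ∀ u v : ℤ × ℤ, (f = u ∨ f = -u) → (g = v ∨ g = -v) →
      ({lax u, lax v, lax (u + v)} : Finset (Sym2 (ℤ × ℤ))) = {lax f, lax g, lax (f + g)} ∨
      ({lax u, lax v, lax (u + v)} : Finset (Sym2 (ℤ × ℤ))) = {lax f, lax g, lax (f - g)} := by
    rintro u v (rfl | rfl) (rfl | rfl)
    · exact Or.inl rfl
    · right; simp [lax_neg]
    · right
      have : -u - g = -(u + g) := by abel
      rw [this, lax_neg, lax_neg]
    · left
      have : -u + -v = -(u + v) := by abel
      rw [this, lax_neg, lax_neg, lax_neg]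
  -- The relation e₁ + e₂ + e₃ = 0 is symmetric, so `key` serves all six ordered pairs of faces; the
  -- rewrites only restore the order of the set.
  have rot := triple_rotate (α := Sym2 (ℤ × ℤ))
  have swap := fun x y z : Sym2 (ℤ × ℤ) => Finset.insert_comm x y {z}
  have s1 : lax (e₂ + -(e₁ + e₂)) = lax e₁ := by rw [← lax_neg e₁]; congr 1; abel
  have s2 : lax (-(e₁ + e₂) + e₁) = lax e₂ := by rw [← lax_neg e₂]; congr 1; abel
  have k12 := key e₁ e₂
  have k21 := key e₂ e₁
  have k23 := key e₂ (-(e₁ + e₂))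
  have k32 := key (-(e₁ + e₂)) e₂
  have k31 := key (-(e₁ + e₂)) e₁
  have k13 := key e₁ (-(e₁ + e₂))
  rw [← lax_neg (e₁ + e₂)] at k12
  rw [add_comm e₂ e₁, ← lax_neg (e₁ + e₂), swap] at k21
  rw [s1, ← rot] at k23
  rw [add_comm (-(e₁ + e₂)) e₂, s1, swap, ← rot] at k32
  rw [s2, rot] at k31
  rw [add_comm e₁ (-(e₁ + e₂)), s2, swap, rot] at k13
  simp only [Finset.mem_insert, Finset.mem_singleton, lax_eq_lax] at hf hg
  rcases hf with hf | hf | hf <;> rcases hg with hg | hg | hg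
  · exact absurd ((lax_eq_lax.2 hf).trans (lax_eq_lax.2 hg).symm) hfg
  · exact k12 hf hg
  · exact k13 hf hg
  · exact k21 hf hg
  · exact absurd ((lax_eq_lax.2 hf).trans (lax_eq_lax.2 hg).symm) hfg
  · exact k23 hf hg
  · exact k31 hf hg
  · exact k32 hf hg
  · exact absurd ((lax_eq_lax.2 hf).trans (lax_eq_lax.2 hg).symm) hfg

/-- The three neighbours of a vertex. -/
lemma adj_vertex {M : SL(2, ℤ)} {T : Superbase} (h : topograph.Adj (vertex M) T) :
    (∃ t : Turn, T = vertex (M * t.mat)) ∨ T = vertex (M * reverseMat) := by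
  obtain ⟨hne, hcard⟩ := h
  obtain ⟨l, l', hll, hint⟩ := Finset.card_eq_two.1 hcard
  have hl : l ∈ (vertex M).1 ∩ T.1 := by simp [hint]
  have hl' : l' ∈ (vertex M).1 ∩ T.1 := by simp [hint]
  rw [Finset.mem_inter, mem_vertex] at hl hl'
  have hTne : T.1 ≠ (vertex M).1 := fun h => hne (Subtype.ext h.symm)
  have key : ∀ f g : ℤ × ℤ, lax (act M f) ∈ T.1 → lax (act M g) ∈ T.1 →
      lax (act M f) ≠ lax (act M g) →
      T.1 = {lax (act M f), lax (act M g), lax (act M (f + g))} ∨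
      T.1 = {lax (act M f), lax (act M g), lax (act M (f - g))} := by
    intro f g hf hg hfg
    have := faces_of_mem hf hg hfg
    rwa [← act_add, sub_eq_add_neg (act M f), ← act_neg, ← act_add, ← sub_eq_add_neg] at this
  -- Of the two superbases through a pair of common faces one is `vertex M` itself, which is
  -- excluded.
  have k1 : lax (act M (1, 0)) ∈ T.1 → lax (act M (0, 1)) ∈ T.1 → T = vertex (M * reverseMat) := by
    intro hf hg
    apply Subtype.ext
    rcases key _ _ hf hg (by rw [Ne, lax_act_eq]; exact lax_fst_ne_snd) with h | h
    · exact absurd (by rw [h, vertex_faces]; simp) hTne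
    · rw [h, vertex_reverse_faces]; simp
  have k2 : lax (act M (1, 0)) ∈ T.1 → lax (act M (1, 1)) ∈ T.1 →
      T = vertex (M * Turn.left.mat) := by
    intro hf hg
    apply Subtype.ext
    rcases key _ _ hf hg (by rw [Ne, lax_act_eq]; exact lax_fst_ne_sum) with h | h
    · rw [h, vertex_left_faces]; simp
    · refine absurd ?_ hTne
      have e : ((1, 0) : ℤ × ℤ) - (1, 1) = -(0, 1) := by simp
      rw [h, vertex_faces, e, act_neg, lax_neg, Finset.pair_comm]
  have k3 : lax (act M (0, 1)) ∈ T.1 → lax (act M (1, 1)) ∈ T.1 →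
      T = vertex (M * Turn.right.mat) := by
    intro hf hg
    apply Subtype.ext
    rcases key _ _ hf hg (by rw [Ne, lax_act_eq]; exact lax_snd_ne_sum) with h | h
    · rw [h, vertex_right_faces, Finset.insert_comm]; simp
    · refine absurd ?_ hTne
      have e : ((0, 1) : ℤ × ℤ) - (1, 1) = -(1, 0) := by simp
      rw [h, vertex_faces, e, act_neg, lax_neg, triple_rotate, triple_rotate]
  obtain ⟨hl, hlT⟩ := hl
  obtain ⟨hl', hlT'⟩ := hl'
  rcases hl with rfl | rfl | rfl <;> rcases hl' with rfl | rfl | rfl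
  · exact absurd rfl hll
  · exact Or.inr (k1 hlT hlT')
  · exact Or.inl ⟨.left, k2 hlT hlT'⟩
  · exact Or.inr (k1 hlT' hlT)
  · exact absurd rfl hll
  · exact Or.inl ⟨.right, k3 hlT hlT'⟩
  · exact Or.inl ⟨.left, k2 hlT' hlT⟩
  · exact Or.inl ⟨.right, k3 hlT' hlT⟩
  · exact absurd rfl hll

/-- Every oriented edge is given by a matrix. -/
lemma exists_edge {S T : Superbase} (h : topograph.Adj S T) :
    ∃ M, S = vertex (M * reverseMat) ∧ T = vertex M := by
  obtain ⟨M, rfl⟩ := exists_vertex_eq S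
  rcases adj_vertex h with ⟨t, rfl⟩ | rfl
  · exact ⟨M * t.mat, (vertex_mul_turn_reverse M t).symm, rfl⟩
  · exact ⟨M * reverseMat, (vertex_mul_reverse_reverse M).symm, rfl⟩

/-- The tree is connected. -/
lemma topograph_reachable (S : Superbase) : topograph.Reachable S initialVertex := by
  obtain ⟨M, rfl⟩ := exists_vertex_eq S
  -- As right multipliers the generators `S` and `T` cross an edge and make a left turn, so a word
  -- in them is a walk in the tree.
  have hM : M ∈ Subgroup.closure {ModularGroup.S, ModularGroup.T} := by
    rw [SpecialLinearGroup.SL2Z_generators]; trivial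
  have hS : ModularGroup.S = reverseMat := rfl
  have hT : ModularGroup.T = Turn.left.mat := rfl
  induction hM using Subgroup.closure_induction_right with
  | one => exact SimpleGraph.Reachable.refl _
  | mul_right x hx y hy ih =>
    refine SimpleGraph.Reachable.trans (SimpleGraph.Adj.reachable ?_) ih
    rcases hy with rfl | rfl
    · rw [hS]; exact adj_reverse x
    · rw [hT]; exact (adj_turn x _).symm
  | mul_inv_cancel x hx y hy ih =>
    refine SimpleGraph.Reachable.trans (SimpleGraph.Adj.reachable ?_) ih
    rcases hy with rfl | rfl
    · have := adj_reverse (x * ModularGroup.S⁻¹)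
      rw [← hS, inv_mul_cancel_right] at this
      exact this.symm
    · have := adj_turn (x * ModularGroup.T⁻¹) .left
      rwa [← hT, inv_mul_cancel_right] at this

/-! ### The orientation of the tree towards an irrational end -/

/-- The linear form that vanishes on the line of slope `ξ`. -/
def linForm (ξ : ℝ) (w : ℤ × ℤ) : ℝ := (w.1 : ℝ) - ξ * (w.2 : ℝ)

lemma linForm_add (ξ : ℝ) (v w : ℤ × ℤ) : linForm ξ (v + w) = linForm ξ v + linForm ξ w := by
  simp [linForm]; ring

lemma linForm_neg (ξ : ℝ) (v : ℤ × ℤ) : linForm ξ (-v) = -linForm ξ v := by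
  simp [linForm]; ring

lemma linForm_act (ξ : ℝ) (M : SL(2, ℤ)) (w : ℤ × ℤ) : linForm ξ (act M w) =
    w.1 * linForm ξ (act M (1, 0)) + w.2 * linForm ξ (act M (0, 1)) := by
  simp [linForm, act]; ring

lemma linForm_ne_zero {ξ : ℝ} (hξ : Irrational ξ) {w : ℤ × ℤ} (hw : w ≠ 0) :
    linForm ξ w ≠ 0 := by
  intro h
  by_cases h2 : w.2 = 0
  · simp only [linForm, h2, Int.cast_zero, mul_zero, sub_zero, Int.cast_eq_zero] at h
    exact hw (Prod.ext h h2)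
  · have h2' : (w.2 : ℝ) ≠ 0 := by exact_mod_cast h2
    apply hξ
    refine ⟨(w.1 : ℚ) / (w.2 : ℚ), ?_⟩
    push_cast
    rw [div_eq_iff h2']
    unfold linForm at h
    linarith

lemma linForm_act_ne_zero {ξ : ℝ} (hξ : Irrational ξ) (M : SL(2, ℤ)) {w : ℤ × ℤ} (hw : w ≠ 0) :
    linForm ξ (act M w) ≠ 0 :=
  linForm_ne_zero hξ (by rwa [Ne, act_eq_zero])

lemma div_sub_eq {ξ : ℝ} {w : ℤ × ℤ} (hw : w.2 ≠ 0) :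
    |(w.1 : ℝ) / (w.2 : ℝ) - ξ| = |linForm ξ w| / |(w.2 : ℝ)| := by
  have h2 : (w.2 : ℝ) ≠ 0 := by exact_mod_cast hw
  rw [← abs_div]
  congr 1
  unfold linForm
  field_simp

/-- The oriented edge `M` points to the end `ξ`. -/
def Points (M : SL(2, ℤ)) (ξ : ℝ) : Prop :=
  linForm ξ (act M (1, 0)) * linForm ξ (act M (0, 1)) < 0

/-- The absolute value of the linear form at a face. -/
def faceWeight (ξ : ℝ) : Sym2 (ℤ × ℤ) → ℝ :=
  Sym2.lift ⟨fun v w => max |linForm ξ v| |linForm ξ w|, fun _ _ => max_comm _ _⟩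

lemma faceWeight_lax (ξ : ℝ) (v : ℤ × ℤ) : faceWeight ξ (lax v) = |linForm ξ v| := by
  simp [faceWeight, lax, linForm_neg]

/-- The sum of the absolute values of the linear form at the faces of a vertex. -/
def weight (ξ : ℝ) (S : Superbase) : ℝ := ∑ l ∈ S.1, faceWeight ξ l

/-- The step from `S` to `T` leads closer to the end `ξ`. -/
def Toward (ξ : ℝ) (S T : Superbase) : Prop := topograph.Adj S T ∧ weight ξ T < weight ξ S

lemma weight_vertex (ξ : ℝ) (M : SL(2, ℤ)) : weight ξ (vertex M) =
    |linForm ξ (act M (1, 0))| + |linForm ξ (act M (0, 1))| +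
      |linForm ξ (act M (1, 0)) + linForm ξ (act M (0, 1))| := by
  unfold weight
  rw [vertex_faces, Finset.sum_insert, Finset.sum_insert, Finset.sum_singleton, faceWeight_lax,
    faceWeight_lax, faceWeight_lax, linForm_act ξ M (1, 1)]
  · push_cast; ring_nf
  · simp only [Finset.mem_singleton, lax_act_eq]; exact lax_snd_ne_sum
  · simp only [Finset.mem_insert, Finset.mem_singleton, lax_act_eq, not_or]
    exact ⟨lax_fst_ne_snd, lax_fst_ne_sum⟩

lemma linForm_reverse_fst (ξ : ℝ) (M : SL(2, ℤ)) :
    linForm ξ (act (M * reverseMat) (1, 0)) = linForm ξ (act M (0, 1)) := by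
  rw [act_mul]; simp [act, reverseMat]

lemma linForm_reverse_snd (ξ : ℝ) (M : SL(2, ℤ)) :
    linForm ξ (act (M * reverseMat) (0, 1)) = -linForm ξ (act M (1, 0)) := by
  rw [act_mul, ← linForm_neg, ← act_neg]; simp [act, reverseMat]

/-- The ends of an edge share the faces with values x and y; the third faces contribute |x + y| and
|x - y|, whose squares differ by 4xy. -/
lemma toward_reverse_iff {ξ : ℝ} {M : SL(2, ℤ)} :
    Toward ξ (vertex (M * reverseMat)) (vertex M) ↔ Points M ξ := by
  unfold Toward Points
  rw [weight_vertex, weight_vertex, linForm_reverse_fst, linForm_reverse_snd, abs_neg]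
  set x := linForm ξ (act M (1, 0))
  set y := linForm ξ (act M (0, 1))
  have h : |x + y| < |y + -x| ↔ x * y < 0 := by
    rw [← sq_lt_sq]
    constructor <;> intro h <;> nlinarith
  rw [← h]
  constructor
  · rintro ⟨-, h⟩; linarith
  · intro h; exact ⟨adj_reverse M, by linarith⟩

lemma points_reverse_iff {ξ : ℝ} {M : SL(2, ℤ)} : Points (M * reverseMat) ξ ↔
    0 < linForm ξ (act M (1, 0)) * linForm ξ (act M (0, 1)) := by
  unfold Points
  rw [linForm_reverse_fst, linForm_reverse_snd]
  constructor <;> intro h <;> nlinarith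

lemma toward_from_iff {ξ : ℝ} {M : SL(2, ℤ)} :
    Toward ξ (vertex M) (vertex (M * reverseMat)) ↔ Points (M * reverseMat) ξ := by
  rw [← toward_reverse_iff, vertex_mul_reverse_reverse]

lemma toward_turn_iff {ξ : ℝ} {M : SL(2, ℤ)} {t : Turn} :
    Toward ξ (vertex M) (vertex (M * t.mat)) ↔ Points (M * t.mat) ξ := by
  rw [← toward_reverse_iff, vertex_mul_turn_reverse]

lemma points_left_iff {ξ : ℝ} {M : SL(2, ℤ)} : Points (M * Turn.left.mat) ξ ↔
    linForm ξ (act M (1, 0)) * (linForm ξ (act M (1, 0)) + linForm ξ (act M (0, 1))) < 0 := by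
  unfold Points
  rw [act_mul, act_mul, act_left, act_left, ← linForm_add, ← act_add]
  simp

lemma points_right_iff {ξ : ℝ} {M : SL(2, ℤ)} : Points (M * Turn.right.mat) ξ ↔
    (linForm ξ (act M (1, 0)) + linForm ξ (act M (0, 1))) * linForm ξ (act M (0, 1)) < 0 := by
  unfold Points
  rw [act_mul, act_mul, act_right, act_right, ← linForm_add, ← act_add]
  simp

lemma linForm_sum_ne_zero {ξ : ℝ} (hξ : Irrational ξ) (M : SL(2, ℤ)) :
    linForm ξ (act M (1, 0)) + linForm ξ (act M (0, 1)) ≠ 0 := by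
  rw [← linForm_add, ← act_add]
  exact linForm_act_ne_zero hξ M (by simp)

lemma points_or_reverse {ξ : ℝ} (hξ : Irrational ξ) (M : SL(2, ℤ)) :
    Points M ξ ∨ Points (M * reverseMat) ξ := by
  rw [points_reverse_iff]
  exact lt_or_gt_of_ne (mul_ne_zero (linForm_act_ne_zero hξ M (by simp))
    (linForm_act_ne_zero hξ M (by simp)))

lemma not_points_iff {ξ : ℝ} (hξ : Irrational ξ) {M : SL(2, ℤ)} :
    ¬ Points M ξ ↔ Points (M * reverseMat) ξ := by
  refine ⟨(points_or_reverse hξ M).resolve_left, fun h h' => ?_⟩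
  rw [points_reverse_iff] at h
  exact lt_asymm h h'

/-- An edge that points to an end has a continuation that points to this end. -/
lemma Points.exists_turn {ξ : ℝ} (hξ : Irrational ξ) {M : SL(2, ℤ)} (hM : Points M ξ) :
    ∃ t : Turn, Points (M * t.mat) ξ := by
  have h1 := linForm_act_ne_zero hξ M (w := (1, 0)) (by simp)
  have h3 := linForm_sum_ne_zero hξ M
  rcases lt_or_gt_of_ne (mul_ne_zero h1 h3) with h | h
  · exact ⟨.left, points_left_iff.2 h⟩
  · refine ⟨.right, points_right_iff.2 ?_⟩
    have h4 := mul_neg_of_pos_of_neg h hM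
    have h5 := sq_pos_of_ne_zero h1
    by_contra hc
    push Not at hc
    nlinarith [mul_nonneg h5.le hc]

/-- An edge does not point to an end if its predecessor does not. -/
lemma Points.of_turn {ξ : ℝ} {M : SL(2, ℤ)} {t : Turn} (h : Points (M * t.mat) ξ) :
    Points M ξ := by
  cases t
  · rw [points_left_iff] at h
    unfold Points
    nlinarith [sq_nonneg (linForm ξ (act M (1, 0)))]
  · rw [points_right_iff] at h
    unfold Points
    nlinarith [sq_nonneg (linForm ξ (act M (0, 1)))]

/-- With s = x + y the value at the sum face, one turn needs x s < 0 and the other s y < 0; the sum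
of these is s ^ 2 < 0. -/
lemma points_turn_unique {ξ : ℝ} {M : SL(2, ℤ)} {t t' : Turn} (h : Points (M * t.mat) ξ)
    (h' : Points (M * t'.mat) ξ) : t = t' := by
  have hs := sq_nonneg (linForm ξ (act M (1, 0)) + linForm ξ (act M (0, 1)))
  cases t <;> cases t' <;> first | rfl | skip
  · rw [points_left_iff] at h
    rw [points_right_iff] at h'
    nlinarith
  · rw [points_left_iff] at h'
    rw [points_right_iff] at h
    nlinarith

lemma Toward.unique {ξ : ℝ} {S T T' : Superbase} (h : Toward ξ S T) (h' : Toward ξ S T') :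
    T = T' := by
  obtain ⟨M, rfl⟩ := exists_vertex_eq S
  have key : ∀ t : Turn, Points (M * t.mat) ξ → ¬ Points (M * reverseMat) ξ := by
    intro t ht h
    have := ht.of_turn
    rw [points_reverse_iff] at h
    exact lt_asymm h this
  rcases adj_vertex h.1 with ⟨t, rfl⟩ | rfl <;> rcases adj_vertex h'.1 with ⟨t', rfl⟩ | rfl
  · rw [toward_turn_iff] at h h'
    rw [points_turn_unique h h']
  · rw [toward_turn_iff] at h
    rw [toward_from_iff] at h'
    exact absurd h' (key t h)
  · rw [toward_turn_iff] at h'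
    rw [toward_from_iff] at h
    exact absurd h (key t' h')
  · rfl

lemma Toward.not_symm {ξ : ℝ} {S T : Superbase} (h : Toward ξ S T) : ¬ Toward ξ T S :=
  fun h' => lt_asymm h.2 h'.2

lemma toward_or {ξ : ℝ} (hξ : Irrational ξ) {S T : Superbase} (h : topograph.Adj S T) :
    Toward ξ S T ∨ Toward ξ T S := by
  obtain ⟨M, rfl, rfl⟩ := exists_edge h
  rw [toward_reverse_iff, toward_from_iff]
  exact points_or_reverse hξ M

/-- Two orbits towards the same end agree if they start at the same vertex. -/
lemma toward_orbit_unique {ξ : ℝ} {γ γ' : ℕ → Superbase} (h0 : γ 0 = γ' 0) {m : ℕ}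
    (h : ∀ n < m, Toward ξ (γ n) (γ (n + 1))) (h' : ∀ n < m, Toward ξ (γ' n) (γ' (n + 1))) :
    ∀ n ≤ m, γ n = γ' n := by
  intro n
  induction n with
  | zero => exact fun _ => h0
  | succ n ih =>
    intro hn
    have h1 := h n (by omega)
    have h2 := h' n (by omega)
    rw [ih (by omega)] at h1
    exact h1.unique h2

lemma toward_orbit_weight {ξ : ℝ} {γ : ℕ → Superbase} (h : ∀ n, Toward ξ (γ n) (γ (n + 1))) :
    StrictAnti fun n => weight ξ (γ n) :=
  strictAnti_nat_of_succ_lt fun n => (h n).2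

lemma toward_orbit_injective {ξ : ℝ} {γ : ℕ → Superbase}
    (h : ∀ n, Toward ξ (γ n) (γ (n + 1))) : Function.Injective γ := by
  intro m n hmn
  exact (toward_orbit_weight h).injective (congrArg (weight ξ) hmn)

/-! ### Convergence to the end -/

lemma finite_box (ξ K C : ℝ) : {w : ℤ × ℤ | |(w.2 : ℝ)| ≤ K ∧ |linForm ξ w| ≤ C}.Finite := by
  refine ((Set.finite_Icc (-⌈C + |ξ| * K⌉) ⌈C + |ξ| * K⌉).prod
    (Set.finite_Icc (-⌈K⌉) ⌈K⌉)).subset ?_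
  rintro w ⟨h2, h1⟩
  have hb : |(w.1 : ℝ)| ≤ C + |ξ| * K := by
    have : (w.1 : ℝ) = linForm ξ w + ξ * w.2 := by simp [linForm]
    rw [this]
    refine (abs_add_le _ _).trans (add_le_add h1 ?_)
    rw [abs_mul]
    exact mul_le_mul_of_nonneg_left h2 (abs_nonneg _)
  have aux : ∀ (z : ℤ) (B : ℝ), |(z : ℝ)| ≤ B → -⌈B⌉ ≤ z ∧ z ≤ ⌈B⌉ := by
    intro z B hz
    have := (abs_le.1 (hz.trans (Int.le_ceil B)))
    exact ⟨by exact_mod_cast this.1, by exact_mod_cast this.2⟩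
  exact ⟨aux _ _ hb, aux _ _ h2⟩

/-- For a fixed first vector the determinant relation bounds the denominator of the second, so each
value of `p n` occurs for finitely many n; and the values with bounded denominator and bounded
linear form lie in a finite box. -/
lemma finite_small_denominators {ξ : ℝ} (hξ : Irrational ξ) {p q : ℕ → ℤ × ℤ} {C : ℝ}
    (hp : ∀ n, |linForm ξ (p n)| ≤ C) (hq : ∀ n, |linForm ξ (q n)| ≤ C)
    (hdet : ∀ n, |(p n).1 * (q n).2 - (p n).2 * (q n).1| = 1)
    (hinj : Function.Injective fun n => (p n, q n)) (K : ℝ) :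
    {n | |((p n).2 : ℝ)| ≤ K}.Finite := by
  have hfib : ∀ u, {n | p n = u}.Finite := by
    intro u
    by_cases hu : u = 0
    · convert Set.finite_empty (α := ℕ)
      ext n
      simp only [Set.mem_ofPred_eq, Set.mem_empty_iff_false, iff_false]
      intro h
      have := hdet n
      rw [h, hu] at this
      simp at this
    refine Set.Finite.of_finite_image (f := q)
      ((finite_box ξ ((1 + |(u.2 : ℝ)| * C) / |linForm ξ u|) C).subset ?_) ?_
    · rintro _ ⟨n, rfl, rfl⟩
      refine ⟨?_, hq n⟩
      have hpos : 0 < |linForm ξ (p n)| := abs_pos.2 (linForm_ne_zero hξ hu)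
      rw [le_div_iff₀ hpos, ← abs_mul]
      have e : ((q n).2 : ℝ) * linForm ξ (p n) =
          (((p n).1 * (q n).2 - (p n).2 * (q n).1 : ℤ) : ℝ) + (p n).2 * linForm ξ (q n) := by
        simp only [linForm]; push_cast; ring
      rw [e]
      refine (abs_add_le _ _).trans (add_le_add ?_ ?_)
      · rw [← Int.cast_abs, hdet]; simp
      · rw [abs_mul]; exact mul_le_mul_of_nonneg_left (hq n) (abs_nonneg _)
    · intro m hm n hn hmn
      exact hinj (Prod.ext (Eq.trans hm (Eq.symm hn)) hmn)
  refine ((finite_box ξ K C).biUnion fun u _ => hfib u).subset ?_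
  intro n hn
  simp only [Set.mem_iUnion]
  exact ⟨p n, ⟨hn, hp n⟩, rfl⟩

/-- The column that changes has the sign opposite to the kept one before and after the kept one is
added to it, so it shrinks. -/
lemma abs_linForm_turn_le {ξ : ℝ} {M : SL(2, ℤ)} {t : Turn} (h : Points (M * t.mat) ξ) :
    |linForm ξ (act (M * t.mat) (1, 0))| + |linForm ξ (act (M * t.mat) (0, 1))| <
      |linForm ξ (act M (1, 0))| + |linForm ξ (act M (0, 1))| := by
  have aux : ∀ x y : ℝ, x * (x + y) < 0 → |x + y| < |y| := by
    intro x y h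
    rw [← sq_lt_sq]
    nlinarith [sq_nonneg x]
  cases t
  · have h' := aux _ _ (points_left_iff.1 h)
    have e1 : act (M * Turn.left.mat) (1, 0) = act M (1, 0) := by rw [act_mul, act_left]; simp
    have e2 : act (M * Turn.left.mat) (0, 1) = act M (1, 0) + act M (0, 1) := by
      rw [act_mul, act_left, ← act_add]; simp
    rw [e1, e2, linForm_add]
    linarith
  · have h' := aux (linForm ξ (act M (0, 1))) (linForm ξ (act M (1, 0)))
      (by rw [add_comm, mul_comm]; exact points_right_iff.1 h)
    have e1 : act (M * Turn.right.mat) (1, 0) = act M (0, 1) + act M (1, 0) := by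
      rw [act_mul, act_right, ← act_add]; simp
    have e2 : act (M * Turn.right.mat) (0, 1) = act M (0, 1) := by
      rw [act_mul, act_right]; simp
    rw [e1, e2, linForm_add]
    linarith

/-- Allows the third face of a vertex to be estimated as a column of the next matrix. -/
lemma sum_column_mem (M : SL(2, ℤ)) (t : Turn) : act M (1, 1) = act (M * t.mat) (1, 0) ∨
    act M (1, 1) = act (M * t.mat) (0, 1) := by
  cases t
  · right; rw [act_mul, act_left]; simp
  · left; rw [act_mul, act_right]; simp

/-- A sequence of turns that always points to `ξ` leads to `ξ`. -/
lemma leadsTo_of_points {ξ : ℝ} (hξ : Irrational ξ) {M : ℕ → SL(2, ℤ)} {t : ℕ → Turn}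
    (hM : ∀ n, M (n + 1) = M n * (t n).mat) (hP : ∀ n, Points (M n) ξ) :
    LeadsTo (fun n => vertex (M n)) atTop ξ := by
  intro ε hε
  set E : ℕ → ℝ := fun n => |linForm ξ (act (M n) (1, 0))| + |linForm ξ (act (M n) (0, 1))|
    with hE
  have hanti : StrictAnti E := by
    refine strictAnti_nat_of_succ_lt fun n => ?_
    have := hP (n + 1)
    rw [hM] at this
    simp only [hE, hM]
    exact abs_linForm_turn_le this
  have hb1 : ∀ n, |linForm ξ (act (M n) (1, 0))| ≤ E 0 := fun n =>
    (le_add_of_nonneg_right (abs_nonneg _)).trans (hanti.antitone (Nat.zero_le n))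
  have hb2 : ∀ n, |linForm ξ (act (M n) (0, 1))| ≤ E 0 := fun n =>
    (le_add_of_nonneg_left (abs_nonneg _)).trans (hanti.antitone (Nat.zero_le n))
  have hinj : Function.Injective fun n => (act (M n) (1, 0), act (M n) (0, 1)) := by
    intro m n hmn
    simp only [Prod.mk.injEq] at hmn
    apply hanti.injective
    simp only [hE, hmn.1, hmn.2]
  have hdet : ∀ n, (act (M n) (1, 0)).1 * (act (M n) (0, 1)).2 -
      (act (M n) (1, 0)).2 * (act (M n) (0, 1)).1 = 1 := by
    intro n
    have := det_eq (M n)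
    simp only [act]
    linarith
  have hf1 := finite_small_denominators hξ hb1 hb2 (fun n => by rw [hdet n]; simp) hinj (E 0 / ε)
  have hf2 := finite_small_denominators hξ hb2 hb1
    (fun n => by
      rw [show ∀ x y z w : ℤ, x * y - z * w = -(w * z - y * x) from fun _ _ _ _ => by ring,
        abs_neg, hdet n, abs_one])
    (fun m n hmn => hinj (Prod.ext (congrArg Prod.snd hmn) (congrArg Prod.fst hmn))) (E 0 / ε)
  have hev : ∀ᶠ n in atTop, E 0 / ε < |((act (M n) (1, 0)).2 : ℝ)| ∧
      E 0 / ε < |((act (M n) (0, 1)).2 : ℝ)| := by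
    rw [← Nat.cofinite_eq_atTop]
    filter_upwards [hf1.eventually_cofinite_notMem, hf2.eventually_cofinite_notMem] with n h1 h2
    exact ⟨not_le.1 h1, not_le.1 h2⟩
  obtain ⟨N, hN⟩ := eventually_atTop.1 hev
  have hE0 : 0 ≤ E 0 := add_nonneg (abs_nonneg _) (abs_nonneg _)
  have good : ∀ w : ℤ × ℤ, E 0 / ε < |(w.2 : ℝ)| → |linForm ξ w| ≤ E 0 →
      w.2 ≠ 0 ∧ |(w.1 : ℝ) / (w.2 : ℝ) - ξ| < ε := by
    intro w hw hw'
    have hpos : 0 < |(w.2 : ℝ)| := lt_of_le_of_lt (by positivity) hw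
    have h2 : w.2 ≠ 0 := by
      intro h; rw [h] at hpos; simp at hpos
    refine ⟨h2, ?_⟩
    rw [div_sub_eq h2, div_lt_iff₀ hpos]
    rw [div_lt_iff₀ hε] at hw
    linarith
  have good' : ∀ n ≥ N, ∀ l ∈ (vertex (M n)).1, ∃ w, l = lax w ∧ w.2 ≠ 0 ∧
      |(w.1 : ℝ) / (w.2 : ℝ) - ξ| < ε := by
    intro n hn l hl
    have g1 := fun m hm => good _ (hN m hm).1 (hb1 m)
    have g2 := fun m hm => good _ (hN m hm).2 (hb2 m)
    rcases mem_vertex.1 hl with rfl | rfl | rfl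
    · exact ⟨_, rfl, g1 n hn⟩
    · exact ⟨_, rfl, g2 n hn⟩
    · refine ⟨_, rfl, ?_⟩
      rcases sum_column_mem (M n) (t n) with h | h
      · rw [h, ← hM]; exact g1 (n + 1) (by omega)
      · rw [h, ← hM]; exact g2 (n + 1) (by omega)
  filter_upwards [eventually_ge_atTop N] with n hn v hv
  obtain ⟨w, hvw, hw⟩ := good' n hn _ hv
  rcases lax_eq_lax.1 hvw with rfl | rfl
  · exact hw
  · simpa [neg_div_neg_eq] using hw

lemma LeadsTo.of_succ {γ : ℕ → Superbase} {ξ : ℝ} (h : LeadsTo (fun n => γ (n + 1)) atTop ξ) :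
    LeadsTo γ atTop ξ := by
  intro ε hε
  obtain ⟨N, hN⟩ := eventually_atTop.1 (h ε hε)
  refine eventually_atTop.2 ⟨N + 1, fun n hn => ?_⟩
  have := hN (n - 1) (by omega)
  simp only [Nat.sub_add_cancel (show 1 ≤ n by omega)] at this
  exact this

lemma exists_mem_faces (S : Superbase) : ∃ v, lax v ∈ S.1 := by
  obtain ⟨M, rfl⟩ := exists_vertex_eq S
  exact ⟨_, mem_vertex.2 (Or.inl rfl)⟩

lemma LeadsTo.unique {γ : ℕ → Superbase} {ξ ξ' : ℝ} (h : LeadsTo γ atTop ξ)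
    (h' : LeadsTo γ atTop ξ') : ξ = ξ' := by
  by_contra hne
  have hpos : 0 < |ξ - ξ'| / 2 := by
    have := abs_pos.2 (sub_ne_zero.2 hne)
    linarith
  obtain ⟨n, h1, h2⟩ := ((h _ hpos).and (h' _ hpos)).exists
  obtain ⟨v, hv⟩ := exists_mem_faces (γ n)
  have h1 := (h1 v hv).2
  have h2 := (h2 v hv).2
  have h3 := abs_sub_le ξ ((v.1 : ℝ) / v.2) ξ'
  rw [abs_sub_comm ξ (_ / _)] at h3
  linarith

/-- Every orbit towards the end `ξ` leads to `ξ`. -/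
lemma leadsTo_of_toward {ξ : ℝ} (hξ : Irrational ξ) {γ : ℕ → Superbase}
    (h : ∀ n, Toward ξ (γ n) (γ (n + 1))) : LeadsTo γ atTop ξ := by
  obtain ⟨M₀, h0, h1⟩ := exists_edge (h 0).1
  have hM₀ : Points M₀ ξ := by
    rw [← toward_reverse_iff, ← h0, ← h1]
    exact h 0
  have : Nonempty Turn := ⟨.left⟩
  choose! t ht using fun M => Points.exists_turn hξ (M := M)
  set M : ℕ → SL(2, ℤ) := fun n => Nat.rec M₀ (fun _ X => X * (t X).mat) n with hM
  have hs : ∀ n, M (n + 1) = M n * (t (M n)).mat := fun n => rfl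
  have hP : ∀ n, Points (M n) ξ := by
    intro n
    induction n with
    | zero => exact hM₀
    | succ n ih => rw [hs]; exact ht _ ih
  have hl := leadsTo_of_points hξ hs hP
  -- The matrix `M₀` belongs to the first edge, so the matrices describe the path from its second
  -- vertex on.
  apply LeadsTo.of_succ
  convert hl using 2 with n
  refine toward_orbit_unique (ξ := ξ) (γ := fun n => γ (n + 1)) (γ' := fun n => vertex (M n)) h1
    (m := n) (fun k _ => h (k + 1)) (fun k _ => ?_) n le_rfl
  have := hP (k + 1)
  rw [hs] at this
  simp only [hs]
  exact toward_turn_iff.2 this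

/-- The fractions in the half tree behind an edge that does not point to `ξ` stay away from `ξ`. -/
lemma exists_distance {ξ : ℝ} (hξ : Irrational ξ) {M : SL(2, ℤ)} (hM : ¬ Points M ξ) :
    ∃ δ > 0, ∀ w : ℤ × ℤ, 0 ≤ w.1 → 0 ≤ w.2 → (act M w).2 ≠ 0 →
      δ ≤ |((act M w).1 : ℝ) / ((act M w).2 : ℝ) - ξ| := by
  rw [not_points_iff hξ, points_reverse_iff] at hM
  set x := linForm ξ (act M (1, 0)) with hx
  set y := linForm ξ (act M (0, 1)) with hy
  have hx0 : 0 < |x| := abs_pos.2 (left_ne_zero_of_mul hM.ne')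
  have hy0 : 0 < |y| := abs_pos.2 (right_ne_zero_of_mul hM.ne')
  have hc : (0 : ℝ) < |(M 1 0 : ℝ)| + 1 := by positivity
  have hd : (0 : ℝ) < |(M 1 1 : ℝ)| + 1 := by positivity
  -- On nonnegative w the linear form has absolute value w.1 * |x| + w.2 * |y|, so it is enough to
  -- compare it with the denominator column by column. The + 1 avoids division by a vanishing entry.
  refine ⟨min (|x| / (|(M 1 0 : ℝ)| + 1)) (|y| / (|(M 1 1 : ℝ)| + 1)),
    lt_min (div_pos hx0 hc) (div_pos hy0 hd), fun w h1 h2 hne => ?_⟩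
  set δ := min (|x| / (|(M 1 0 : ℝ)| + 1)) (|y| / (|(M 1 1 : ℝ)| + 1)) with hδ
  have hδ0 : 0 < δ := lt_min (div_pos hx0 hc) (div_pos hy0 hd)
  have b1 : δ * |(M 1 0 : ℝ)| ≤ |x| := by
    have := (le_div_iff₀ hc).1 (min_le_left (|x| / (|(M 1 0 : ℝ)| + 1)) _ : δ ≤ _)
    linarith
  have b2 : δ * |(M 1 1 : ℝ)| ≤ |y| := by
    have := (le_div_iff₀ hd).1 (min_le_right _ (|y| / (|(M 1 1 : ℝ)| + 1)) : δ ≤ _)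
    linarith
  have hpos : (0 : ℝ) < |((act M w).2 : ℝ)| := abs_pos.2 (by exact_mod_cast hne)
  have h1' : (0 : ℝ) ≤ w.1 := by exact_mod_cast h1
  have h2' : (0 : ℝ) ≤ w.2 := by exact_mod_cast h2
  rw [div_sub_eq hne, le_div_iff₀ hpos, linForm_act]
  have e : |(w.1 : ℝ) * x + w.2 * y| = w.1 * |x| + w.2 * |y| := by
    rcases pos_and_pos_or_neg_and_neg_of_mul_pos hM with ⟨hx', hy'⟩ | ⟨hx', hy'⟩
    · rw [abs_of_pos hx', abs_of_pos hy', abs_of_nonneg (by positivity)]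
    · rw [abs_of_neg hx', abs_of_neg hy', abs_of_nonpos (by nlinarith)]; ring
  rw [← hx, ← hy, e]
  have e2 : |((act M w).2 : ℝ)| ≤ |(M 1 0 : ℝ)| * w.1 + |(M 1 1 : ℝ)| * w.2 := by
    simp only [act]
    push_cast
    refine (abs_add_le _ _).trans ?_
    rw [abs_mul, abs_mul, abs_of_nonneg h1', abs_of_nonneg h2']
  calc δ * |((act M w).2 : ℝ)| ≤ δ * (|(M 1 0 : ℝ)| * w.1 + |(M 1 1 : ℝ)| * w.2) := by gcongr
    _ = w.1 * (δ * |(M 1 0 : ℝ)|) + w.2 * (δ * |(M 1 1 : ℝ)|) := by ring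
    _ ≤ w.1 * |x| + w.2 * |y| := by gcongr

/-- All entries of the matrix are nonnegative. -/
def NonnegEntries (W : SL(2, ℤ)) : Prop := ∀ i j, 0 ≤ W i j

lemma nonnegEntries_one : NonnegEntries 1 := by
  intro i j; fin_cases i <;> fin_cases j <;> simp

lemma NonnegEntries.mul {A B : SL(2, ℤ)} (hA : NonnegEntries A) (hB : NonnegEntries B) :
    NonnegEntries (A * B) := by
  intro i j
  rw [mul_entry]
  exact add_nonneg (mul_nonneg (hA _ _) (hB _ _)) (mul_nonneg (hA _ _) (hB _ _))

lemma nonnegEntries_turn (t : Turn) : NonnegEntries t.mat := by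
  intro i j; cases t <;> fin_cases i <;> fin_cases j <;> simp [Turn.mat]

/-- A path without repetitions that moves away from `ξ` does not lead to `ξ`. -/
lemma toward_of_leadsTo {ξ : ℝ} (hξ : Irrational ξ) {γ : ℕ → Superbase}
    (hadj : ∀ n, topograph.Adj (γ n) (γ (n + 1))) (hinj : Function.Injective γ)
    (hl : LeadsTo γ atTop ξ) (n : ℕ) : Toward ξ (γ n) (γ (n + 1)) := by
  by_contra hn
  obtain ⟨M, h0, h1⟩ := exists_edge (hadj n)
  have hM : ¬ Points M ξ := by rwa [← toward_reverse_iff, ← h0, ← h1]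
  have hstep : ∀ k, ∃ W, NonnegEntries W ∧ γ (n + k) = vertex (M * W * reverseMat) ∧
      γ (n + k + 1) = vertex (M * W) := by
    intro k
    induction k with
    | zero => exact ⟨1, nonnegEntries_one, by rwa [mul_one], by rwa [mul_one]⟩
    | succ k ih =>
      obtain ⟨W, hW, hk, hk'⟩ := ih
      have ha := hadj (n + k + 1)
      rw [hk'] at ha
      rcases adj_vertex ha with ⟨t, ht⟩ | ht
      · refine ⟨W * t.mat, hW.mul (nonnegEntries_turn t), ?_, ?_⟩
        · rw [← mul_assoc, vertex_mul_turn_reverse, ← hk', add_assoc]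
        · rw [← mul_assoc, ← ht, add_assoc n k 1]
      -- Crossing back would revisit `γ (n + k)`; only turns remain, so the path stays in the half
      -- tree that the edge `M` enters.
      · rw [← hk] at ht
        have := hinj ht
        omega
  obtain ⟨δ, hδ, hd⟩ := exists_distance hξ hM
  obtain ⟨N, hN⟩ := eventually_atTop.1 (hl δ hδ)
  obtain ⟨W, hW, -, hk⟩ := hstep N
  obtain ⟨h2, h3⟩ := hN (n + N + 1) (by omega) (act (M * W) (1, 0))
    (by rw [hk]; exact mem_vertex.2 (Or.inl rfl))
  have hw : act W (1, 0) = (W 0 0, W 1 0) := by simp [act]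
  rw [act_mul, hw] at h2 h3
  exact absurd h3 (not_lt.2 (hd _ (hW 0 0) (hW 1 0) h2))

/-- The orbit from the initial vertex towards `ξ` is the only ray to `ξ`. -/
lemma isUniqueRayTo_of_toward {ξ : ℝ} (hξ : Irrational ξ) {γ : ℕ → Superbase}
    (h0 : γ 0 = initialVertex) (h : ∀ n, Toward ξ (γ n) (γ (n + 1))) : IsUniqueRayTo γ ξ := by
  refine ⟨⟨h0, fun n => (h n).1, toward_orbit_injective h, leadsTo_of_toward hξ h⟩, ?_⟩
  rintro γ' ⟨h0', hadj, hinj, hl⟩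
  funext n
  exact toward_orbit_unique (m := n) (h0'.trans h0.symm)
    (fun k _ => toward_of_leadsTo hξ hadj hinj hl k) (fun k _ => h k) n le_rfl

/-! ### The river -/

/-- The numbers `α` and `α'` are the two different roots of the form, and they are irrational. -/
structure ConjugateRoots (a h b : ℤ) (α α' : ℝ) : Prop where
  lead : a ≠ 0
  irrational : Irrational α
  irrational' : Irrational α'
  ne : α ≠ α'
  sum : (h : ℝ) = -(a * (α + α'))
  prod : (b : ℝ) = a * (α * α')

lemma ConjugateRoots.symm {a h b : ℤ} {α α' : ℝ} (R : ConjugateRoots a h b α α') :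
    ConjugateRoots a h b α' α where
  lead := R.lead
  irrational := R.irrational'
  irrational' := R.irrational
  ne := R.ne.symm
  sum := by rw [R.sum]; ring
  prod := by rw [R.prod]; ring

lemma ConjugateRoots.form_eq {a h b : ℤ} {α α' : ℝ} (R : ConjugateRoots a h b α α') (w : ℤ × ℤ) :
    (form a h b w : ℝ) = a * linForm α w * linForm α' w := by
  unfold form linForm
  push_cast
  rw [R.sum, R.prod]
  ring

lemma form_neg (a h b : ℤ) (w : ℤ × ℤ) : form a h b (-w) = form a h b w := by
  simp [form]

lemma form_eq_of_lax_eq {a h b : ℤ} {v w : ℤ × ℤ} (hvw : lax v = lax w) :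
    form a h b v = form a h b w := by
  rcases lax_eq_lax.1 hvw with rfl | rfl
  · rfl
  · exact form_neg a h b w

lemma mem_edge_faces {M : SL(2, ℤ)} {l : Sym2 (ℤ × ℤ)} :
    l ∈ (vertex (M * reverseMat)).1 ∩ (vertex M).1 ↔
      l = lax (act M (1, 0)) ∨ l = lax (act M (0, 1)) := by
  rw [Finset.mem_inter, vertex_reverse_faces, vertex_faces]
  simp only [Finset.mem_insert, Finset.mem_singleton]
  constructor
  · rintro ⟨h1 | h1 | rfl, h2 | h2 | h2⟩ <;> try tauto
    rw [lax_act_eq, lax_eq_lax] at h2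
    exact absurd h2 (by decide)
  · tauto

lemma river_adj_edge {a h b : ℤ} {M : SL(2, ℤ)} :
    (river a h b).Adj (vertex (M * reverseMat)) (vertex M) ↔
      form a h b (act M (1, 0)) * form a h b (act M (0, 1)) < 0 := by
  constructor
  · rintro ⟨-, u, v, hu, hv, hu', hv'⟩
    rw [mem_edge_faces] at hu hv
    rcases hu with hu | hu <;> rcases hv with hv | hv <;> rw [form_eq_of_lax_eq hu] at hu' <;>
      rw [form_eq_of_lax_eq hv] at hv'
    · omega
    · exact mul_neg_of_pos_of_neg hu' hv'
    · exact mul_neg_of_neg_of_pos hv' hu'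
    · omega
  · intro hneg
    refine ⟨adj_reverse M, ?_⟩
    rcases mul_neg_iff.1 hneg with ⟨h1, h2⟩ | ⟨h1, h2⟩
    · exact ⟨_, _, mem_edge_faces.2 (Or.inl rfl), mem_edge_faces.2 (Or.inr rfl), h1, h2⟩
    · exact ⟨_, _, mem_edge_faces.2 (Or.inr rfl), mem_edge_faces.2 (Or.inl rfl), h2, h1⟩

/-- By `ConjugateRoots.form_eq` the product of the two values is a ^ 2 times one product of linear
values for each root. The sign condition of the river becomes a condition on orientations. -/
lemma ConjugateRoots.form_mul_form_neg_iff {a h b : ℤ} {α α' : ℝ} (R : ConjugateRoots a h b α α')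
    (M : SL(2, ℤ)) : form a h b (act M (1, 0)) * form a h b (act M (0, 1)) < 0 ↔
      (Points M α ∧ ¬ Points M α') ∨ (Points M α' ∧ ¬ Points M α) := by
  rw [not_points_iff R.irrational', not_points_iff R.irrational, points_reverse_iff,
    points_reverse_iff]
  unfold Points
  have e : ((form a h b (act M (1, 0)) * form a h b (act M (0, 1)) : ℤ) : ℝ) =
      (a : ℝ) ^ 2 * ((linForm α (act M (1, 0)) * linForm α (act M (0, 1))) *
        (linForm α' (act M (1, 0)) * linForm α' (act M (0, 1)))) := by
    push_cast
    rw [R.form_eq, R.form_eq]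
    ring
  have ha : (0 : ℝ) < (a : ℝ) ^ 2 := by
    have : (a : ℝ) ≠ 0 := by exact_mod_cast R.lead
    positivity
  rw [← Int.cast_lt_zero (R := ℝ), e, mul_neg_iff, or_iff_left (fun h => lt_asymm ha h.1),
    and_iff_right ha, mul_neg_iff]
  tauto

/-- The edges of the river are those which separate the two ends. -/
lemma ConjugateRoots.river_adj_iff {a h b : ℤ} {α α' : ℝ} (R : ConjugateRoots a h b α α')
    {S T : Superbase} : (river a h b).Adj S T ↔
      (Toward α S T ∧ Toward α' T S) ∨ (Toward α' S T ∧ Toward α T S) := by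
  constructor
  · intro hST
    obtain ⟨M, rfl, rfl⟩ := exists_edge hST.1
    rw [river_adj_edge, R.form_mul_form_neg_iff, not_points_iff R.irrational',
      not_points_iff R.irrational] at hST
    rwa [toward_reverse_iff, toward_reverse_iff, toward_from_iff, toward_from_iff]
  · intro hST
    have hadj : topograph.Adj S T := by
      rcases hST with h | h
      · exact h.1.1
      · exact h.1.1
    obtain ⟨M, rfl, rfl⟩ := exists_edge hadj
    rw [river_adj_edge, R.form_mul_form_neg_iff, not_points_iff R.irrational',
      not_points_iff R.irrational]
    rwa [toward_reverse_iff, toward_reverse_iff, toward_from_iff, toward_from_iff] at hST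

/-- The path `γ` and the paths to `ξ` part at the vertex number `N`. -/
def PartsAt (γ : ℕ → Superbase) (ξ : ℝ) (N : ℕ) : Prop :=
  (∀ n < N, Toward ξ (γ n) (γ (n + 1))) ∧ Toward ξ (γ (N + 1)) (γ N)

/-- After a step away from ξ the only descending edge leads back along that step, and a path without
repetitions cannot take it. -/
lemma PartsAt.toward {γ : ℕ → Superbase} {ξ : ℝ} (hξ : Irrational ξ) {N : ℕ}
    (hadj : ∀ n, topograph.Adj (γ n) (γ (n + 1))) (hinj : Function.Injective γ)
    (hN : PartsAt γ ξ N) {n : ℕ} (hn : N ≤ n) : Toward ξ (γ (n + 1)) (γ n) := by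
  induction n, hn using Nat.le_induction with
  | base => exact hN.2
  | succ n hn ih =>
    refine (toward_or hξ (hadj (n + 1))).resolve_left fun h => ?_
    have := hinj (h.unique ih)
    omega

/-- A path that forever approaches both ends would converge to both. -/
lemma exists_partsAt {γ : ℕ → Superbase} {α α' : ℝ} (hα : Irrational α) (hα' : Irrational α')
    (hne : α ≠ α') (h : ∀ n, Toward α (γ n) (γ (n + 1))) : ∃ N, PartsAt γ α' N := by
  classical
  have hex : ∃ n, ¬ Toward α' (γ n) (γ (n + 1)) := by
    by_contra! hc
    exact hne ((leadsTo_of_toward hα h).unique (leadsTo_of_toward hα' hc))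
  refine ⟨Nat.find hex, fun n hn => not_not.1 (Nat.find_min hex hn), ?_⟩
  exact (toward_or hα' (h _).1).resolve_left (Nat.find_spec hex)

/-- A river edge at `S` leaves `S` towards exactly one of the ends; by uniqueness of descent it
would be the edge to `T`, which leads to both. -/
lemma ConjugateRoots.notMem_support {a h b : ℤ} {α α' : ℝ} (R : ConjugateRoots a h b α α')
    {S T : Superbase} (h1 : Toward α S T) (h2 : Toward α' S T) : S ∉ (river a h b).support := by
  intro hS
  obtain ⟨U, hU⟩ := SimpleGraph.mem_support _ |>.1 hS
  rcases R.river_adj_iff.1 hU with ⟨h3, h4⟩ | ⟨h3, h4⟩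
  · rw [← h1.unique h3] at h4
    exact h2.not_symm h4
  · rw [← h2.unique h3] at h4
    exact h1.not_symm h4

lemma ConjugateRoots.river_adj_of_partsAt {a h b : ℤ} {α α' : ℝ} (R : ConjugateRoots a h b α α')
    {γ : ℕ → Superbase} (hγ : ∀ n, Toward α (γ n) (γ (n + 1))) {N : ℕ} (hN : PartsAt γ α' N)
    {n : ℕ} (hn : N ≤ n) : (river a h b).Adj (γ n) (γ (n + 1)) :=
  R.river_adj_iff.2 (Or.inl ⟨hγ n, hN.toward R.irrational' (fun k => (hγ k).1)
    (toward_orbit_injective hγ) hn⟩)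

lemma ConjugateRoots.goesToRiver {a h b : ℤ} {α α' : ℝ} (R : ConjugateRoots a h b α α')
    {γ : ℕ → Superbase} (hγ : ∀ n, Toward α (γ n) (γ (n + 1))) : GoesToRiver a h b γ := by
  obtain ⟨N, hN⟩ := exists_partsAt R.irrational R.irrational' R.ne hγ
  exact ⟨N, fun n hn => R.notMem_support (hγ n) (hN.1 n hn),
    fun n hn => R.river_adj_of_partsAt hγ hN hn⟩

lemma exists_walk {V : Type*} {G : SimpleGraph V} {γ : ℕ → V} (h : ∀ n, G.Adj (γ n) (γ (n + 1)))
    {v : V} (h0 : γ 0 = v) (N : ℕ) :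
    ∃ p : G.Walk v (γ N), p.length = N ∧ ∀ n ≤ N, p.getVert n = γ n := by
  subst h0
  induction N with
  | zero => exact ⟨.nil, rfl, fun n hn => by simp [Nat.le_zero.1 hn]⟩
  | succ N ih =>
    obtain ⟨p, hp, hv⟩ := ih
    refine ⟨p.append (.cons (h N) .nil), by simp [hp], fun n hn => ?_⟩
    rw [SimpleGraph.Walk.getVert_append']
    split_ifs with hlt
    · exact hv n (by omega)
    · obtain rfl : n = N + 1 := by omega
      simp [hp]

/-- The approach to the river is the part of the path to `α` up to the vertex where it parts from
the path to `α'`. -/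
lemma ConjugateRoots.approachIs {a h b : ℤ} {α α' : ℝ} (R : ConjugateRoots a h b α α')
    {γ : ℕ → Superbase} (h0 : γ 0 = initialVertex) (hγ : ∀ n, Toward α (γ n) (γ (n + 1)))
    {w : List ℕ} (hN : PartsAt γ α' w.sum)
    (hw : ∀ n ≤ w.sum, γ n = path (fun i => w.getD i 0) n) : ApproachIs a h b w := by
  have hoff : ∀ n < w.sum, γ n ∉ (river a h b).support := fun n hn =>
    R.notMem_support (hγ n) (hN.1 n hn)
  have hon : γ w.sum ∈ (river a h b).support :=
    (SimpleGraph.mem_support _).2 ⟨_, R.river_adj_of_partsAt hγ hN le_rfl⟩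
  have hinj := toward_orbit_injective hγ
  refine ⟨?_, ?_⟩
  · obtain ⟨p, hp, hv⟩ := exists_walk (G := topograph) (fun n => (hγ n).1) h0 w.sum
    have hpath : p.IsPath := by
      rw [← SimpleGraph.Walk.IsPath.getVert_injOn_iff]
      intro i hi j hj hij
      rw [Set.mem_ofPred_eq, hp] at hi hj
      rw [hv i hi, hv j hj] at hij
      exact hinj hij
    refine ⟨_, p, ⟨hpath, hon, ?_⟩, hp, fun n hn => (hv n hn).trans (hw n hn)⟩
    intro T hT hTr
    obtain ⟨n, rfl, hn⟩ := SimpleGraph.Walk.mem_support_iff_exists_getVert.1 hT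
    rw [hp] at hn
    rw [hv n hn] at hTr ⊢
    rcases hn.lt_or_eq with hlt | rfl
    · exact absurd hTr (hoff n hlt)
    · rfl
  · rintro S p ⟨hp, hS, hlast⟩
    have hpinj : ∀ i ≤ p.length, ∀ j ≤ p.length, p.getVert i = p.getVert j → i = j :=
      fun i hi j hj hij => hp.getVert_injOn hi hj hij
    have hend : p.getVert p.length = S := p.getVert_length
    have hoff' : ∀ i < p.length, p.getVert i ∉ (river a h b).support := by
      intro i hi hmem
      have := hlast _ (p.getVert_mem_support i) hmem
      exact hi.ne (hpinj i hi.le _ le_rfl (this.trans hend.symm))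
    have hadj : ∀ i < p.length, topograph.Adj (p.getVert i) (p.getVert (i + 1)) :=
      fun i hi => p.adj_getVert_succ hi
    have hnr : ∀ i < p.length, ¬ (river a h b).Adj (p.getVert i) (p.getVert (i + 1)) :=
      fun i hi hr => hoff' i hi ((SimpleGraph.mem_support _).2 ⟨_, hr⟩)
    have hboth : ∀ i < p.length,
        (Toward α (p.getVert i) (p.getVert (i + 1)) ∧
          Toward α' (p.getVert i) (p.getVert (i + 1))) ∨
        (Toward α (p.getVert (i + 1)) (p.getVert i) ∧
          Toward α' (p.getVert (i + 1)) (p.getVert i)) := by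
      intro i hi
      have h3 := hnr i hi
      rw [R.river_adj_iff] at h3
      rcases toward_or R.irrational (hadj i hi) with h1 | h1 <;>
        rcases toward_or R.irrational' (hadj i hi) with h2 | h2 <;> tauto
    have hback : ∀ i j, i ≤ j → j < p.length → Toward α (p.getVert (i + 1)) (p.getVert i) →
        Toward α (p.getVert (j + 1)) (p.getVert j) := by
      intro i j hij
      induction j, hij using Nat.le_induction with
      | base => exact fun _ h => h
      | succ j hij ih =>
        intro hj hi
        have h1 := ih (by omega) hi
        refine (toward_or R.irrational (hadj (j + 1) hj)).resolve_left fun h2 => ?_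
        have := hpinj _ (by omega) _ (by omega) (h2.unique h1)
        omega
    -- If some step led away from both ends, so would the last one; both ends would then lie behind
    -- `S`, and `S` would be off the river.
    have hforw : ∀ i < p.length, Toward α (p.getVert i) (p.getVert (i + 1)) ∧
        Toward α' (p.getVert i) (p.getVert (i + 1)) := by
      intro i hi
      refine (hboth i hi).resolve_right fun hb => ?_
      have h1 := hback i (p.length - 1) (by omega) (by omega) hb.1
      have h2 := (hboth (p.length - 1) (by omega)).resolve_left fun h2 => h2.1.not_symm h1
      rw [Nat.sub_add_cancel (by omega), hend] at h2
      exact R.notMem_support h2.1 h2.2 hS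
    have hagree : ∀ n ≤ p.length, p.getVert n = γ n :=
      toward_orbit_unique (ξ := α) (γ := p.getVert) (by rw [h0, p.getVert_zero])
        (fun i hi => (hforw i hi).1) (fun i _ => hγ i)
    have hlen : p.length = w.sum := by
      rcases lt_trichotomy p.length w.sum with hlt | heq | hgt
      · have := hoff _ hlt
        rw [← hagree _ le_rfl, hend] at this
        exact absurd hS this
      · exact heq
      · have := hoff' _ hgt
        rw [hagree _ hgt.le] at this
        exact absurd hon this
    exact ⟨hlen, fun n hn => by rw [hagree n (by omega), hw n hn]⟩

/-! ### Paths and complete quotients -/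

lemma Turn.flip_flip (t : Turn) : t.flip.flip = t := by cases t <;> rfl

lemma Turn.flip_ne (t : Turn) : t.flip ≠ t := by cases t <;> simp [Turn.flip]

lemma blockTurn_succ (j : ℕ) : blockTurn (j + 1) = (blockTurn j).flip := by
  unfold blockTurn
  by_cases hj : Even j <;> simp [hj, Nat.even_add_one, Turn.flip]

/-- The column of the matrices that a turn does not change. -/
def Turn.kept : Turn → ℤ × ℤ
  | .left => (1, 0)
  | .right => (0, 1)

lemma Turn.kept_ne_zero (t : Turn) : t.kept ≠ 0 := by
  cases t <;> simp [Turn.kept]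

lemma act_turn_kept (t : Turn) : act t.mat t.kept = t.kept := by
  cases t <;> simp [act_left, act_right, Turn.kept]

lemma act_turn_kept_flip (t : Turn) : act t.mat t.flip.kept = t.flip.kept + t.kept := by
  cases t <;> simp [act_left, act_right, Turn.kept, Turn.flip]

/-- The number `x` such that the Möbius transformation `M` maps `x` (before a left turn) or `1 / x`
(before a right turn) to `ξ`. -/
def quot (ξ : ℝ) (M : SL(2, ℤ)) (t : Turn) : ℝ :=
  -linForm ξ (act M t.flip.kept) / linForm ξ (act M t.kept)

lemma quot_one (ξ : ℝ) : quot ξ 1 .left = ξ := by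
  simp [quot, Turn.kept, Turn.flip, linForm, act_one]

lemma quot_mul_turn {ξ : ℝ} (hξ : Irrational ξ) (M : SL(2, ℤ)) (t : Turn) :
    quot ξ (M * t.mat) t = quot ξ M t - 1 := by
  have h := linForm_act_ne_zero hξ M t.kept_ne_zero
  unfold quot
  rw [act_mul, act_mul, act_turn_kept, act_turn_kept_flip, act_add, linForm_add]
  field_simp
  ring

lemma quot_mul_turn_pow {ξ : ℝ} (hξ : Irrational ξ) (M : SL(2, ℤ)) (t : Turn) (r : ℕ) :
    quot ξ (M * t.mat ^ r) t = quot ξ M t - r := by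
  induction r with
  | zero => simp
  | succ r ih =>
    rw [pow_succ, ← mul_assoc, quot_mul_turn hξ, ih]
    push_cast
    ring

lemma quot_flip (ξ : ℝ) (M : SL(2, ℤ)) (t : Turn) : quot ξ M t.flip = (quot ξ M t)⁻¹ := by
  unfold quot
  rw [t.flip_flip, inv_div, div_neg, neg_div]

lemma points_iff_quot_pos {ξ : ℝ} (hξ : Irrational ξ) (M : SL(2, ℤ)) (t : Turn) :
    Points M ξ ↔ 0 < quot ξ M t := by
  have h1 := linForm_act_ne_zero hξ M t.kept_ne_zero
  have e : quot ξ M t = -(linForm ξ (act M t.flip.kept) * linForm ξ (act M t.kept)) /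
      linForm ξ (act M t.kept) ^ 2 := by
    unfold quot
    field_simp
  rw [e, lt_div_iff₀ (by positivity), zero_mul, neg_pos]
  cases t
  · rw [mul_comm]; rfl
  · rfl

/-- The number of turns in the blocks of the sequence is infinite. -/
def InfinitelyManyTurns (c : ℕ → ℕ) : Prop := ∀ n, ∃ j, n < ∑ i ∈ Finset.range j, c i

lemma sum_range_mono (c : ℕ → ℕ) : Monotone fun j => ∑ i ∈ Finset.range j, c i :=
  monotone_nat_of_le_succ fun j => by rw [Finset.sum_range_succ]; omega

lemma turnOf_eq {c : ℕ → ℕ} {j n : ℕ} (h1 : ∑ i ∈ Finset.range j, c i ≤ n)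
    (h2 : n < ∑ i ∈ Finset.range (j + 1), c i) : turnOf c n = blockTurn j := by
  unfold turnOf
  congr 1
  refine IsLeast.csInf_eq ⟨h2, fun j' hj' => ?_⟩
  by_contra hlt
  have : ∑ i ∈ Finset.range (j' + 1), c i ≤ ∑ i ∈ Finset.range j, c i :=
    sum_range_mono c (by omega)
  have hj'' : n < ∑ i ∈ Finset.range (j' + 1), c i := hj'
  omega

lemma InfinitelyManyTurns.exists_block {c : ℕ → ℕ} (hc : InfinitelyManyTurns c) (n : ℕ) :
    ∃ j r, n = ∑ i ∈ Finset.range j, c i + r ∧ r < c j := by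
  classical
  have hex : ∃ j, n < ∑ i ∈ Finset.range (j + 1), c i := by
    obtain ⟨j, hj⟩ := hc n
    exact ⟨j, hj.trans_le (sum_range_mono c (Nat.le_succ j))⟩
  have h1 := Nat.find_spec hex
  have h2 : ∑ i ∈ Finset.range (Nat.find hex), c i ≤ n := by
    rcases Nat.eq_zero_or_pos (Nat.find hex) with h | h
    · rw [h]; simp
    · have := Nat.find_min hex (Nat.sub_lt h one_pos)
      rw [show Nat.find hex - 1 + 1 = Nat.find hex from Nat.sub_add_cancel h] at this
      omega
  rw [Finset.sum_range_succ] at h1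
  exact ⟨Nat.find hex, n - ∑ i ∈ Finset.range (Nat.find hex), c i, by omega, by omega⟩

/-- The matrix of the path before the block with number `j`. -/
def blockMatrix (c : ℕ → ℕ) (j : ℕ) : SL(2, ℤ) := pathMatrix c (∑ i ∈ Finset.range j, c i)

lemma pathMatrix_block {c : ℕ → ℕ} (j : ℕ) {r : ℕ} (hr : r ≤ c j) :
    pathMatrix c (∑ i ∈ Finset.range j, c i + r) = blockMatrix c j * (blockTurn j).mat ^ r := by
  induction r with
  | zero => simp [blockMatrix]
  | succ r ih =>
    rw [← add_assoc, pathMatrix, ih (by omega), turnOf_eq (j := j) (by omega)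
      (by rw [Finset.sum_range_succ]; omega), pow_succ, mul_assoc]

lemma blockMatrix_succ (c : ℕ → ℕ) (j : ℕ) :
    blockMatrix c (j + 1) = blockMatrix c j * (blockTurn j).mat ^ c j := by
  rw [← pathMatrix_block j le_rfl, blockMatrix, Finset.sum_range_succ]

lemma quot_blockMatrix_zero (ξ : ℝ) (c : ℕ → ℕ) : quot ξ (blockMatrix c 0) (blockTurn 0) = ξ :=
  quot_one ξ

/-- Each turn of the block subtracts 1 and the change of side inverts: the path performs the
continued fraction algorithm, also when the block is empty. -/
lemma quot_blockMatrix_succ {ξ : ℝ} (hξ : Irrational ξ) (c : ℕ → ℕ) (j : ℕ) :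
    quot ξ (blockMatrix c (j + 1)) (blockTurn (j + 1)) =
      (quot ξ (blockMatrix c j) (blockTurn j) - c j)⁻¹ := by
  rw [blockMatrix_succ, blockTurn_succ, quot_flip, quot_mul_turn_pow hξ]

/-- The number `ξ` has positive complete quotients in an expansion with the partial quotients
`c 0, c 1, …`. -/
def HasQuotients (c : ℕ → ℕ) (ξ : ℝ) : Prop :=
  ∃ q : ℕ → ℝ, q 0 = ξ ∧ ∀ n, 0 < q n ∧ q n = c n + 1 / q (n + 1)

lemma quot_blockMatrix {c : ℕ → ℕ} {ξ : ℝ} (hξ : Irrational ξ) {q : ℕ → ℝ} (h0 : q 0 = ξ)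
    (hq : ∀ n, q n = c n + 1 / q (n + 1)) (j : ℕ) :
    quot ξ (blockMatrix c j) (blockTurn j) = q j := by
  induction j with
  | zero => rw [quot_blockMatrix_zero, h0]
  | succ j ih =>
    rw [quot_blockMatrix_succ hξ, ih, hq j]
    simp

lemma HasQuotients.points {c : ℕ → ℕ} {ξ : ℝ} (hξ : Irrational ξ) (hc : InfinitelyManyTurns c)
    (h : HasQuotients c ξ) (n : ℕ) : Points (pathMatrix c n) ξ := by
  obtain ⟨q, h0, hq⟩ := h
  have hx := quot_blockMatrix (c := c) hξ h0 fun n => (hq n).2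
  obtain ⟨j, r, rfl, hr⟩ := hc.exists_block n
  rw [pathMatrix_block j hr.le, points_iff_quot_pos hξ _ (blockTurn j), quot_mul_turn_pow hξ, hx,
    (hq j).2]
  have h1 : (r : ℝ) < c j := by exact_mod_cast hr
  have h2 := one_div_pos.2 (hq (j + 1)).1
  linarith

lemma hasQuotients_of_points {c : ℕ → ℕ} {ξ : ℝ} (hξ : Irrational ξ)
    (h : ∀ n, Points (pathMatrix c n) ξ) : HasQuotients c ξ := by
  refine ⟨fun j => quot ξ (blockMatrix c j) (blockTurn j), quot_blockMatrix_zero ξ c, fun j => ?_⟩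
  refine ⟨(points_iff_quot_pos hξ _ _).1 (h _), ?_⟩
  simp only [quot_blockMatrix_succ hξ]
  simp

lemma toward_path {c : ℕ → ℕ} {ξ : ℝ} (h : ∀ n, Points (pathMatrix c n) ξ) (n : ℕ) :
    Toward ξ (path c n) (path c (n + 1)) :=
  toward_turn_iff.2 (h (n + 1))

lemma path_zero (c : ℕ → ℕ) : path c 0 = initialVertex := rfl

/-- The partial quotients determine the path, and the path has only one limit. -/
lemma HasQuotients.unique {c : ℕ → ℕ} {ξ ξ' : ℝ} (hξ : Irrational ξ) (hξ' : Irrational ξ')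
    (hc : InfinitelyManyTurns c) (h : HasQuotients c ξ) (h' : HasQuotients c ξ') : ξ = ξ' :=
  (leadsTo_of_toward hξ (toward_path (h.points hξ hc))).unique
    (leadsTo_of_toward hξ' (toward_path (h'.points hξ' hc)))

lemma HasQuotients.pos {c : ℕ → ℕ} {ξ : ℝ} (h : HasQuotients c ξ) : 0 < ξ := by
  obtain ⟨q, rfl, hq⟩ := h
  exact (hq 0).1

lemma HasQuotients.cons {c : ℕ → ℕ} {ξ : ℝ} (h : HasQuotients (fun n => c (n + 1)) ξ) :
    HasQuotients c (c 0 + 1 / ξ) := by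
  obtain ⟨q, rfl, hq⟩ := h
  refine ⟨fun n => Nat.casesOn n (c 0 + 1 / q 0) q, rfl, fun n => ?_⟩
  cases n with
  | zero => exact ⟨add_pos_of_nonneg_of_pos (Nat.cast_nonneg _) (one_div_pos.2 (hq 0).1), rfl⟩
  | succ n => exact hq n

lemma HasQuotients.tail {c : ℕ → ℕ} {ξ : ℝ} (h : HasQuotients c ξ) :
    ∃ ξ', HasQuotients (fun n => c (n + 1)) ξ' ∧ ξ = c 0 + 1 / ξ' := by
  obtain ⟨q, rfl, hq⟩ := h
  exact ⟨q 1, ⟨fun n => q (n + 1), rfl, fun n => hq (n + 1)⟩, (hq 0).2⟩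

/-! ### Convergents -/

lemma act_turn_pow_kept (t : Turn) (r : ℕ) : act (t.mat ^ r) t.kept = t.kept := by
  induction r with
  | zero => simp [act_one]
  | succ r ih => rw [pow_succ, act_mul, act_turn_kept, ih]

lemma act_turn_pow_kept_flip (t : Turn) (r : ℕ) : act (t.mat ^ r) t.flip.kept =
    t.flip.kept + (r : ℤ) • t.kept := by
  induction r with
  | zero => simp [act_one]
  | succ r ih =>
    rw [pow_succ, act_mul, act_turn_kept_flip, act_add, ih, act_turn_pow_kept]
    push_cast
    rw [add_smul, one_smul, add_assoc]

lemma act_smul (M : SL(2, ℤ)) (r : ℤ) (w : ℤ × ℤ) : act M (r • w) = r • act M w := by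
  ext <;> simp [act] <;> ring

/-- A block of `c n` turns adds `c n` copies of the kept column to the other one, which is then kept
by the next block: this is the classical recurrence of the convergents. -/
lemma contsAux_contFrac (c : ℕ → ℕ) (n : ℕ) :
    (contFrac c).contsAux n = ⟨((act (blockMatrix c n) (blockTurn n).kept).1 : ℝ),
      ((act (blockMatrix c n) (blockTurn n).kept).2 : ℝ)⟩ ∧
    (contFrac c).contsAux (n + 1) =
      ⟨((act (blockMatrix c (n + 1)) (blockTurn (n + 1)).kept).1 : ℝ),
      ((act (blockMatrix c (n + 1)) (blockTurn (n + 1)).kept).2 : ℝ)⟩ := by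
  induction n with
  | zero =>
    constructor
    · simp [GenContFract.contsAux, blockMatrix, pathMatrix, act_one, blockTurn, Turn.kept]
    · rw [blockMatrix_succ, blockTurn_succ, act_mul, act_turn_pow_kept_flip]
      simp [GenContFract.contsAux, blockMatrix, pathMatrix, act_one, blockTurn, Turn.kept,
        Turn.flip, contFrac]
  | succ n ih =>
    refine ⟨ih.2, ?_⟩
    have hs : (contFrac c).s.get? n = some ⟨1, (c (n + 1) : ℝ)⟩ := rfl
    have hk : act (blockMatrix c (n + 1)) (blockTurn n).kept =
        act (blockMatrix c n) (blockTurn n).kept := by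
      rw [blockMatrix_succ, act_mul, act_turn_pow_kept]
    rw [GenContFract.contsAux_recurrence hs ih.1 ih.2, blockMatrix_succ c (n + 1),
      blockTurn_succ (n + 1), act_mul, act_turn_pow_kept_flip, act_add, act_smul,
      blockTurn_succ n, Turn.flip_flip, hk]
    simp [add_comm]

lemma convs_contFrac (c : ℕ → ℕ) (n : ℕ) : (contFrac c).convs n =
    ((act (blockMatrix c (n + 1)) (blockTurn (n + 1)).kept).1 : ℝ) /
      ((act (blockMatrix c (n + 1)) (blockTurn (n + 1)).kept).2 : ℝ) := by
  have h := (contsAux_contFrac c n).2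
  unfold GenContFract.convs GenContFract.nums GenContFract.dens GenContFract.conts
  simp [Stream'.map, Stream'.get, Stream'.tail, h]

lemma lax_kept_mem (M : SL(2, ℤ)) (t : Turn) : lax (act M t.kept) ∈ (vertex M).1 := by
  cases t <;> simp [mem_vertex, Turn.kept]

/-- The convergents are faces met along the path and inherit its limit. -/
lemma hasContFrac_of_points {c : ℕ → ℕ} {ξ : ℝ} (hξ : Irrational ξ) (hc : InfinitelyManyTurns c)
    (h : ∀ n, Points (pathMatrix c n) ξ) : HasContFrac c ξ := by
  refine Metric.tendsto_atTop.2 ?_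
  intro ε hε
  obtain ⟨N, hN⟩ := eventually_atTop.1 (leadsTo_of_toward hξ (toward_path h) ε hε)
  obtain ⟨j, hj⟩ := hc N
  refine ⟨j, fun n hn => ?_⟩
  have hS := sum_range_mono c (show j ≤ n + 1 by omega)
  simp only at hS
  rw [Real.dist_eq, convs_contFrac]
  exact (hN (∑ i ∈ Finset.range (n + 1), c i) (by omega) _ (lax_kept_mem _ _)).2

lemma exists_pathMatrix_add (c : ℕ → ℕ) (n k : ℕ) :
    ∃ W, NonnegEntries W ∧ pathMatrix c (n + k) = pathMatrix c n * W := by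
  induction k with
  | zero => exact ⟨1, nonnegEntries_one, (mul_one _).symm⟩
  | succ k ih =>
    obtain ⟨W, hW, hk⟩ := ih
    exact ⟨W * (turnOf c (n + k)).mat, hW.mul (nonnegEntries_turn _), by
      rw [← add_assoc, pathMatrix, hk, mul_assoc]⟩

lemma NonnegEntries.act_kept {W : SL(2, ℤ)} (hW : NonnegEntries W) (t : Turn) :
    0 ≤ (act W t.kept).1 ∧ 0 ≤ (act W t.kept).2 := by
  cases t
  · simpa [act, Turn.kept] using ⟨hW 0 0, hW 1 0⟩
  · simpa [act, Turn.kept] using ⟨hW 0 1, hW 1 1⟩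

/-- Beyond an edge that does not point to ξ all later convergents keep a positive distance from ξ.
-/
lemma HasContFrac.points {c : ℕ → ℕ} {ξ : ℝ} (hξ : Irrational ξ) (hc : InfinitelyManyTurns c)
    (h : HasContFrac c ξ) (n : ℕ) : Points (pathMatrix c n) ξ := by
  by_contra hn
  obtain ⟨δ, hδ, hd⟩ := exists_distance hξ hn
  -- A convergent with denominator 0 has the default value 0, at distance |ξ| from ξ; the second
  -- bound excludes it.
  obtain ⟨N, hN⟩ := Metric.tendsto_atTop.1 h (min δ |ξ|) (lt_min hδ (abs_pos.2 hξ.ne_zero))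
  obtain ⟨j, hj⟩ := hc n
  have hS := sum_range_mono c (show j ≤ N + j + 1 by omega)
  simp only at hS
  have h1 := hN (N + j) (by omega)
  rw [Real.dist_eq, convs_contFrac] at h1
  obtain ⟨W, hW, hWe⟩ := exists_pathMatrix_add c n (∑ i ∈ Finset.range (N + j + 1), c i - n)
  rw [Nat.add_sub_cancel' (by omega)] at hWe
  rw [blockMatrix, hWe, act_mul] at h1
  have hk := hW.act_kept (blockTurn (N + j + 1))
  by_cases h2 : (act (pathMatrix c n) (act W (blockTurn (N + j + 1)).kept)).2 = 0
  · rw [h2] at h1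
    simp at h1
  · exact absurd (h1.trans_le (min_le_left _ _)) (not_lt.2 (hd _ hk.1 hk.2 h2))

lemma HasContFrac.hasQuotients {c : ℕ → ℕ} {ξ : ℝ} (hξ : Irrational ξ)
    (hc : InfinitelyManyTurns c) (h : HasContFrac c ξ) : HasQuotients c ξ :=
  hasQuotients_of_points hξ (h.points hξ hc)

lemma ConjugateRoots.describes {a h b : ℤ} {α α' : ℝ} (R : ConjugateRoots a h b α α')
    {c : ℕ → ℕ} (hc : InfinitelyManyTurns c) (hq : HasQuotients c α) : Describes a h b c α := by
  have hp := hq.points R.irrational hc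
  exact ⟨hasContFrac_of_points R.irrational hc hp,
    isUniqueRayTo_of_toward R.irrational rfl (toward_path hp), R.goesToRiver (toward_path hp)⟩

/-! ### Reflected paths -/

/-- The reflection of an oriented edge. -/
def reflectMat (M : SL(2, ℤ)) : SL(2, ℤ) := ⟨!![-M 0 1, -M 0 0; M 1 1, M 1 0], by
  rw [Matrix.det_fin_two]
  have := det_eq M
  simp
  linarith⟩

lemma reflectedVertex_eq (M : SL(2, ℤ)) : reflectedVertex M = vertex (reflectMat M) := by
  apply Subtype.ext
  simp only [reflectedVertex, vertex, Superbase.ofBasis, reflectMat]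
  rw [Finset.insert_comm]
  simp [add_comm]

/-- The reflection has determinant -1; the exchange of columns in `reflectMat` restores 1 and
thereby swaps left and right. -/
lemma reflectMat_mul_turn (M : SL(2, ℤ)) (t : Turn) :
    reflectMat (M * t.mat) = reflectMat M * t.flip.mat := by
  ext i j
  have e := mul_entry M t.mat
  rw [mul_entry]
  cases t <;> fin_cases i <;> fin_cases j <;> simp [reflectMat, Turn.flip, e] <;>
    simp [Turn.mat] <;> ring

lemma points_reflectMat {M : SL(2, ℤ)} {ξ : ℝ} : Points (reflectMat M) ξ ↔ Points M (-ξ) := by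
  have h1 : linForm ξ (act (reflectMat M) (1, 0)) = -linForm (-ξ) (act M (0, 1)) := by
    simp [linForm, act, reflectMat]; ring
  have h2 : linForm ξ (act (reflectMat M) (0, 1)) = -linForm (-ξ) (act M (1, 0)) := by
    simp [linForm, act, reflectMat]; ring
  unfold Points
  rw [h1, h2, neg_mul_neg, mul_comm]

lemma reflectMat_one : reflectMat 1 = reverseMat := by
  ext i j
  fin_cases i <;> fin_cases j <;> simp [reflectMat, reverseMat]

lemma toward_negPath {c : ℕ → ℕ} {ξ : ℝ} (h : ∀ n, Points (pathMatrix c n) (-ξ)) (n : ℕ) :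
    Toward ξ (negPath c n) (negPath c (n + 1)) := by
  cases n with
  | zero =>
    have h0 := points_reflectMat.2 (h 0)
    simp only [negPath, initialVertex, reflectedVertex_eq]
    rw [pathMatrix, reflectMat_one] at h0 ⊢
    rw [← one_mul reverseMat] at h0 ⊢
    exact toward_from_iff.2 h0
  | succ n =>
    have h0 := points_reflectMat.2 (h (n + 1))
    simp only [negPath, reflectedVertex_eq]
    rw [pathMatrix, reflectMat_mul_turn] at h0 ⊢
    exact toward_turn_iff.2 h0

lemma ConjugateRoots.negDescribes {a h b : ℤ} {α α' : ℝ} (R : ConjugateRoots a h b α α')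
    {c : ℕ → ℕ} (hc : InfinitelyManyTurns c) (hq : HasQuotients c (-α)) :
    NegDescribes a h b c α := by
  have hp := hq.points R.irrational.neg hc
  exact ⟨hasContFrac_of_points R.irrational.neg hc hp,
    isUniqueRayTo_of_toward R.irrational rfl (toward_negPath hp),
    R.goesToRiver (toward_negPath hp)⟩

/-! ### Conjugate irrationals -/

/-- A rational root p/q would make the form vanish at (p, q), and a = 0 would make it vanish at (1,
0). -/
lemma exists_conjugateRoots {a h b : ℤ} (hzero : NotRepresentingZero a h b) {α α' : ℝ}
    (hα : (a : ℝ) * α ^ 2 + (h : ℝ) * α + (b : ℝ) = 0)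
    (hα' : (a : ℝ) * α' ^ 2 + (h : ℝ) * α' + (b : ℝ) = 0) (hne : α' ≠ α) :
    ConjugateRoots a h b α α' := by
  have irr : ∀ x : ℝ, (a : ℝ) * x ^ 2 + (h : ℝ) * x + (b : ℝ) = 0 → Irrational x := by
    rintro _ hx ⟨q, rfl⟩
    have hq : (q.den : ℝ) ≠ 0 := by exact_mod_cast q.den_nz
    refine hzero (q.num, q.den) (by simp) ?_
    have e : (q : ℝ) = q.num / q.den := by exact_mod_cast (Rat.num_div_den q).symm
    rw [e] at hx
    field_simp at hx
    have : ((form a h b (q.num, q.den) : ℤ) : ℝ) = 0 := by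
      simp only [form]
      push_cast
      linarith
    exact_mod_cast this
  have hsum : (h : ℝ) = -(a * (α + α')) := by
    have : (α - α') * (a * (α + α') + h) = 0 := by linear_combination hα - hα'
    rcases mul_eq_zero.1 this with h1 | h1
    · exact absurd (sub_eq_zero.1 h1).symm hne
    · linarith
  refine ⟨fun ha => hzero (1, 0) (by simp) (by simp [form, ha]), irr α hα, irr α' hα', hne.symm,
    hsum, ?_⟩
  rw [hsum] at hα
  linarith

/-- The numbers are the two roots of an integral quadratic equation. -/
def Conjugate (ξ ξ' : ℝ) : Prop := ∃ a h b : ℤ, ConjugateRoots a h b ξ ξ'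

lemma Conjugate.irrational {ξ ξ' : ℝ} (H : Conjugate ξ ξ') : Irrational ξ := by
  obtain ⟨_, _, _, R⟩ := H
  exact R.irrational

lemma Conjugate.irrational' {ξ ξ' : ℝ} (H : Conjugate ξ ξ') : Irrational ξ' := by
  obtain ⟨_, _, _, R⟩ := H
  exact R.irrational'

lemma Conjugate.ne {ξ ξ' : ℝ} (H : Conjugate ξ ξ') : ξ ≠ ξ' := by
  obtain ⟨_, _, _, R⟩ := H
  exact R.ne

/-- Eliminating the square from two quadratic equations leaves an integral linear equation for ξ,
which is nontrivial if the other roots differ; irrationality forbids it. -/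
lemma Conjugate.unique {ξ ξ' ξ'' : ℝ} (H : Conjugate ξ ξ') (H' : Conjugate ξ ξ'') :
    ξ' = ξ'' := by
  obtain ⟨a, h, b, R⟩ := H
  obtain ⟨a', h', b', R'⟩ := H'
  have e1 : ((a' * h - a * h' : ℤ) : ℝ) = a * a' * (ξ'' - ξ') := by
    push_cast; rw [R.sum, R'.sum]; ring
  have e2 : ((a' * b - a * b' : ℤ) : ℝ) = -ξ * (a * a' * (ξ'' - ξ')) := by
    push_cast; rw [R.prod, R'.prod]; ring
  by_contra hne
  have h0 : (a : ℝ) * a' * (ξ'' - ξ') ≠ 0 :=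
    mul_ne_zero (mul_ne_zero (by exact_mod_cast R.lead) (by exact_mod_cast R'.lead))
      (sub_ne_zero.2 (Ne.symm hne))
  have hz : linForm ξ (-(a' * b - a * b'), a' * h - a * h') = 0 := by
    simp only [linForm]
    rw [Int.cast_neg, e1, e2]
    ring
  refine linForm_ne_zero R.irrational ?_ hz
  intro hz'
  have := congrArg Prod.snd hz'
  simp only [Prod.snd_zero] at this
  rw [this, Int.cast_zero] at e1
  exact h0 e1.symm

lemma Conjugate.inv_sub {ξ ξ' : ℝ} (H : Conjugate ξ ξ') (n : ℕ) :
    Conjugate (1 / (ξ - n)) (1 / (ξ' - n)) := by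
  obtain ⟨a, h, b, R⟩ := H
  have h1 : ξ - n ≠ 0 := (R.irrational.sub_natCast n).ne_zero
  have h2 : ξ' - n ≠ 0 := (R.irrational'.sub_natCast n).ne_zero
  have ha : (a : ℝ) ≠ 0 := by exact_mod_cast R.lead
  have e : ((a * n ^ 2 + h * n + b : ℤ) : ℝ) = a * ((ξ - n) * (ξ' - n)) := by
    push_cast; rw [R.sum, R.prod]; ring
  -- The equation for η that results from ξ = n + 1 / η.
  refine ⟨a * n ^ 2 + h * n + b, 2 * a * n + h, a, ?_, ?_, ?_, ?_, ?_, ?_⟩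
  · intro h0
    rw [h0, Int.cast_zero] at e
    exact mul_ne_zero ha (mul_ne_zero h1 h2) e.symm
  · rw [one_div]; exact (R.irrational.sub_natCast n).inv
  · rw [one_div]; exact (R.irrational'.sub_natCast n).inv
  · rw [one_div, one_div, Ne, inv_inj, sub_left_inj]; exact R.ne
  · rw [e]
    push_cast
    rw [R.sum]
    field_simp
    ring
  · rw [e]
    field_simp

/-! ### Periodic continued fractions -/

/-- The value of the finite continued fraction `[a₀, …, aₖ, t]`. -/
def cfEval (l : List ℕ) (t : ℝ) : ℝ := l.foldr (fun a x => (a : ℝ) + 1 / x) t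

@[simp] lemma cfEval_nil (t : ℝ) : cfEval [] t = t := rfl

@[simp] lemma cfEval_cons (a : ℕ) (l : List ℕ) (t : ℝ) :
    cfEval (a :: l) t = a + 1 / cfEval l t := rfl

lemma cfEval_append (l m : List ℕ) (t : ℝ) : cfEval (l ++ m) t = cfEval l (cfEval m t) := by
  simp [cfEval, List.foldr_append]

lemma cfEval_pos (l : List ℕ) {t : ℝ} (ht : 0 < t) : 0 < cfEval l t := by
  induction l with
  | nil => exact ht
  | cons a l ih =>
    exact add_pos_of_nonneg_of_pos (Nat.cast_nonneg a) (one_div_pos.2 ih)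

/-- The relation x = a + 1 / y is equivalent to -(1 / y) = a + 1 / (-(1 / x)), so t ↦ -(1 / t)
reverses the order of the entries. -/
lemma cfEval_reverse (l : List ℕ) (t : ℝ) :
    cfEval l.reverse (-(1 / cfEval l t)) = -(1 / t) := by
  induction l with
  | nil => rfl
  | cons a l ih =>
    rw [List.reverse_cons, cfEval_append, ← ih]
    congr 1
    simp

lemma Conjugate.of_cfEval {ξ ξ' t : ℝ} (l : List ℕ) (H : Conjugate ξ ξ') (h : ξ = cfEval l t) :
    ∃ t', Conjugate t t' ∧ ξ' = cfEval l t' := by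
  induction l generalizing ξ ξ' with
  | nil => exact ⟨ξ', by rwa [← show ξ = t from h], rfl⟩
  | cons a l ih =>
    obtain ⟨t', ht', h'⟩ := ih (H.inv_sub a) (by rw [h]; simp)
    exact ⟨t', ht', by rw [cfEval_cons, ← h']; simp⟩

lemma periodicSeq_cons_zero (a : ℕ) (pre per : List ℕ) : periodicSeq (a :: pre) per 0 = a := by
  simp [periodicSeq]

lemma periodicSeq_cons_succ (a : ℕ) (pre per : List ℕ) (n : ℕ) :
    periodicSeq (a :: pre) per (n + 1) = periodicSeq pre per n := by
  simp [periodicSeq]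

lemma periodicSeq_append_lt (l pre per : List ℕ) {i : ℕ} (hi : i < l.length) :
    periodicSeq (l ++ pre) per i = l.getD i 0 := by
  have : i < (l ++ pre).length := by rw [List.length_append]; omega
  rw [periodicSeq, if_pos this, List.getD_append _ _ _ _ hi]

lemma periodicSeq_append_add (l pre per : List ℕ) (i : ℕ) :
    periodicSeq (l ++ pre) per (l.length + i) = periodicSeq pre per i := by
  induction l with
  | nil => simp
  | cons a l ih =>
    rw [List.cons_append, List.length_cons, show l.length + 1 + i = l.length + i + 1 by omega,
      periodicSeq_cons_succ, ih]

lemma periodicSeq_self (per : List ℕ) : periodicSeq per per = periodicSeq [] per := by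
  funext n
  simp only [periodicSeq, List.length_nil, Nat.not_lt_zero, if_false, Nat.sub_zero]
  split_ifs with h
  · rw [Nat.mod_eq_of_lt h]
  · rw [← Nat.mod_eq_sub_mod (not_lt.1 h)]

lemma periodicSeq_rotate (a : ℕ) (l : List ℕ) :
    (fun n => periodicSeq [] (a :: l) (n + 1)) = periodicSeq [] (l ++ [a]) := by
  funext n
  simp only [periodicSeq, List.length_nil, Nat.not_lt_zero, if_false, Nat.sub_zero,
    List.length_cons, List.length_append]
  have hlt := Nat.mod_lt n (Nat.succ_pos l.length)
  rw [Nat.succ_eq_add_one] at hlt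
  rcases Nat.lt_or_ge (n % (l.length + 1)) l.length with h | h
  · rw [show (n + 1) % (l.length + 1) = n % (l.length + 1) + 1 by
        rw [Nat.add_mod, Nat.mod_eq_of_lt (show 1 < l.length + 1 by omega), Nat.mod_eq_of_lt (by omega)]]
    rw [List.getD_cons_succ, List.getD_append _ _ _ _ (by simpa using h)]
  · have h' : n % (l.length + 1) = l.length := by omega
    have h'' : (n + 1) % (l.length + 1) = 0 := by
      rw [← Nat.mod_add_mod, h', Nat.mod_self]
    simp [h', h'']

lemma periodicSeq_pos {pre per : List ℕ} (hne : per ≠ []) (hper : ∀ x ∈ per, 1 ≤ x) {n : ℕ}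
    (hn : pre.length ≤ n) : 1 ≤ periodicSeq pre per n := by
  have hlt := Nat.mod_lt (n - pre.length) (List.length_pos_iff.2 hne)
  rw [periodicSeq, if_neg (by omega), List.getD_eq_getElem _ _ hlt]
  exact hper _ (List.getElem_mem hlt)

lemma infinitelyManyTurns_periodicSeq {per : List ℕ} (pre : List ℕ) (hne : per ≠ [])
    (hper : ∀ x ∈ per, 1 ≤ x) : InfinitelyManyTurns (periodicSeq pre per) := by
  have key : ∀ n, n ≤ ∑ i ∈ Finset.range (pre.length + n), periodicSeq pre per i := by
    intro n
    induction n with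
    | zero => exact Nat.zero_le _
    | succ n ih =>
      rw [← add_assoc, Finset.sum_range_succ]
      have := periodicSeq_pos (pre := pre) hne hper (n := pre.length + n) (by omega)
      omega
  exact fun n => ⟨_, key (n + 1)⟩

lemma HasQuotients.append {pre per : List ℕ} {t : ℝ} (l : List ℕ)
    (h : HasQuotients (periodicSeq pre per) t) :
    HasQuotients (periodicSeq (l ++ pre) per) (cfEval l t) := by
  induction l with
  | nil => exact h
  | cons a l ih =>
    have := HasQuotients.cons (c := periodicSeq (a :: (l ++ pre)) per) (ξ := cfEval l t)
      (by simpa only [periodicSeq_cons_succ] using ih)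
    rwa [periodicSeq_cons_zero] at this

lemma HasQuotients.of_append {pre per : List ℕ} (l : List ℕ) {ξ : ℝ}
    (h : HasQuotients (periodicSeq (l ++ pre) per) ξ) :
    ∃ t, HasQuotients (periodicSeq pre per) t ∧ ξ = cfEval l t := by
  induction l generalizing ξ with
  | nil => exact ⟨ξ, h, rfl⟩
  | cons a l ih =>
    obtain ⟨ξ', h', rfl⟩ := HasQuotients.tail (c := periodicSeq (a :: (l ++ pre)) per) h
    simp only [periodicSeq_cons_succ] at h'
    obtain ⟨t, ht, rfl⟩ := ih h'
    exact ⟨t, ht, by rw [periodicSeq_cons_zero, cfEval_cons]⟩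

lemma HasQuotients.rotate {a : ℕ} {l : List ℕ} {ξ : ℝ}
    (h : HasQuotients (periodicSeq [] (a :: l)) ξ) :
    ∃ t, HasQuotients (periodicSeq [] (l ++ [a])) t ∧ ξ = a + 1 / t := by
  obtain ⟨t, ht, rfl⟩ := h.tail
  rw [periodicSeq_rotate] at ht
  exact ⟨t, ht, by simp [periodicSeq]⟩

lemma hasQuotients_of_fixed {per : List ℕ} (hne : per ≠ []) {t : ℝ} (ht : 0 < t)
    (hfix : cfEval per t = t) : HasQuotients (periodicSeq [] per) t := by
  refine ⟨fun n => cfEval (per.drop (n % per.length)) t, by simpa using hfix, fun n =>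
    ⟨cfEval_pos _ ht, ?_⟩⟩
  have hlt := Nat.mod_lt n (List.length_pos_iff.2 hne)
  simp only [periodicSeq, List.length_nil, Nat.not_lt_zero, if_false, Nat.sub_zero]
  rw [List.drop_eq_getElem_cons hlt, cfEval_cons, List.getD_eq_getElem _ _ hlt]
  congr 2
  rcases Nat.lt_or_ge (n % per.length + 1) per.length with h | h
  · rw [Nat.add_mod n 1, Nat.mod_eq_of_lt (show 1 < per.length by omega), Nat.mod_eq_of_lt h]
  · have h' : n % per.length + 1 = per.length := by omega
    have h'' : (n + 1) % per.length = 0 := by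
      rw [← Nat.mod_add_mod, h', Nat.mod_self]
    rw [h', h'', List.drop_length, List.drop_zero, hfix, cfEval_nil]

/-- The theorem of Galois: the conjugate of the periodic part is negative, and has the reversed
expansion. -/
lemma exists_periodic_part {α α' : ℝ} (H : Conjugate α α') {pre per : List ℕ} (hne : per ≠ [])
    (hper : ∀ x ∈ per, 1 ≤ x) (h : HasQuotients (periodicSeq pre per) α) :
    ∃ β β', Conjugate β β' ∧ 0 < β ∧ β' < 0 ∧ α = cfEval pre β ∧ α' = cfEval pre β' ∧
      cfEval per β = β ∧ cfEval per β' = β' ∧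
      HasQuotients (periodicSeq [] per.reverse) (-(1 / β')) := by
  have hinf := infinitelyManyTurns_periodicSeq [] hne hper
  rw [← List.append_nil pre] at h
  obtain ⟨β, hβ, hαβ⟩ := h.of_append
  obtain ⟨β', H₁, hαβ'⟩ := H.of_cfEval pre hαβ
  -- The quotient `β₁` after one period has the same expansion as β, hence equals it; so do the
  -- conjugates, and both numbers are fixed by the period.
  have hβ₀ := hβ
  rw [show periodicSeq [] per = periodicSeq (per ++ []) per by
    rw [List.append_nil, periodicSeq_self]] at hβ₀
  obtain ⟨β₁, hβ₁, hββ₁⟩ := hβ₀.of_append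
  obtain ⟨β₁', H₂, hββ₁'⟩ := H₁.of_cfEval per hββ₁
  obtain rfl := hβ.unique H₁.irrational H₂.irrational hinf hβ₁
  obtain rfl := H₁.unique H₂
  -- A positive fixed point of the period has the expansion of β and would coincide with β.
  have hneg : β' < 0 := by
    refine lt_of_le_of_ne (not_lt.1 fun hpos => H₁.ne ?_) H₁.irrational'.ne_zero
    exact hβ.unique H₁.irrational H₁.irrational' hinf
      (hasQuotients_of_fixed hne hpos hββ₁'.symm)
  refine ⟨β, β', H₁, hβ.pos, hneg, hαβ, hαβ', hββ₁.symm, hββ₁'.symm, ?_⟩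
  refine hasQuotients_of_fixed (by simpa using hne)
    (neg_pos.2 (one_div_neg.2 hneg)) ?_
  have := cfEval_reverse per β'
  rwa [← hββ₁'] at this

/-! ### The vertex where two paths part -/

/-- Block `m` may be longer in `c`, because the approach to the river can end inside a block of the
path to α. -/
lemma turnOf_eq_of_agree {c d : ℕ → ℕ} {m n : ℕ} (h : ∀ i < m, c i = d i) (hm : d m ≤ c m)
    (hn : n < ∑ i ∈ Finset.range (m + 1), d i) : turnOf c n = turnOf d n := by
  classical
  have hex : ∃ j, n < ∑ i ∈ Finset.range (j + 1), d i := ⟨m, hn⟩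
  set j := Nat.find hex with hj
  have h1 := Nat.find_spec hex
  have hjm : j ≤ m := Nat.find_min' hex hn
  have h2 : ∑ i ∈ Finset.range j, d i ≤ n := by
    rcases Nat.eq_zero_or_pos j with h0 | h0
    · rw [h0]; simp
    · have := Nat.find_min hex (show j - 1 < j by omega)
      rw [show j - 1 + 1 = j by omega] at this
      omega
  rw [← hj] at h1
  have hS : ∑ i ∈ Finset.range j, c i = ∑ i ∈ Finset.range j, d i :=
    Finset.sum_congr rfl fun i hi => h i (by rw [Finset.mem_range] at hi; omega)
  have hle : d j ≤ c j := by
    rcases hjm.lt_or_eq with h0 | h0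
    · exact (h j h0).ge
    · rw [h0]; exact hm
  rw [turnOf_eq h2 h1]
  rw [Finset.sum_range_succ] at h1
  exact turnOf_eq (by omega) (by rw [Finset.sum_range_succ]; omega)

lemma pathMatrix_eq_of_agree {c d : ℕ → ℕ} {m n : ℕ} (h : ∀ i < m, c i = d i) (hm : d m ≤ c m)
    (hn : n ≤ ∑ i ∈ Finset.range (m + 1), d i) : pathMatrix c n = pathMatrix d n := by
  induction n with
  | zero => rfl
  | succ n ih => rw [pathMatrix, pathMatrix, ih (by omega), turnOf_eq_of_agree h hm (by omega)]

lemma sum_range_getD (l : List ℕ) : ∑ i ∈ Finset.range l.length, l.getD i 0 = l.sum := by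
  induction l with
  | nil => rfl
  | cons a l ih =>
    rw [List.length_cons, Finset.sum_range_succ']
    simp only [List.getD_cons_succ, List.getD_cons_zero]
    rw [ih, List.sum_cons, add_comm]

/-- The approach to the river, if the expansions of the two ends part in the block after `l`. -/
lemma ConjugateRoots.approachIs_of_expansions {a h b : ℤ} {α α' : ℝ}
    (R : ConjugateRoots a h b α α') {l r r' per per' : List ℕ} {d x : ℕ} (hdx : d < x)
    (hc : InfinitelyManyTurns (periodicSeq (l ++ x :: r) per))
    (hc' : InfinitelyManyTurns (periodicSeq (l ++ d :: 1 :: r') per'))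
    (hα : HasQuotients (periodicSeq (l ++ x :: r) per) α)
    (hα' : HasQuotients (periodicSeq (l ++ d :: 1 :: r') per') α') :
    ApproachIs a h b (l ++ [d]) := by
  set c := periodicSeq (l ++ x :: r) per with hcdef
  set c' := periodicSeq (l ++ d :: 1 :: r') per' with hcdef'
  set w : ℕ → ℕ := fun i => (l ++ [d]).getD i 0 with hw
  have hwl : ∀ i < l.length, w i = l.getD i 0 := fun i hi => by
    rw [hw]; exact List.getD_append _ _ _ _ hi
  have hwm : w l.length = d := by simp [hw]
  have hcl : ∀ i < l.length, c i = w i := fun i hi => by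
    rw [hwl i hi]; exact periodicSeq_append_lt _ _ _ hi
  have hcl' : ∀ i < l.length, c' i = w i := fun i hi => by
    rw [hwl i hi]; exact periodicSeq_append_lt _ _ _ hi
  have hcm : c l.length = x := by
    have := periodicSeq_append_add l (x :: r) per 0
    rwa [add_zero, periodicSeq_cons_zero] at this
  have hcm' : c' l.length = d := by
    have := periodicSeq_append_add l (d :: 1 :: r') per' 0
    rwa [add_zero, periodicSeq_cons_zero] at this
  -- This nonzero entry makes turn number `N` of `c'` a turn to the other side, while `c`, having x
  -- > d, is still inside the old block.
  have hcm1 : c' (l.length + 1) = 1 := by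
    have := periodicSeq_append_add l (d :: 1 :: r') per' 1
    rwa [periodicSeq_cons_succ, periodicSeq_cons_zero] at this
  have hsum : ∑ i ∈ Finset.range (l.length + 1), w i = (l ++ [d]).sum := by
    rw [← sum_range_getD, List.length_append]; rfl
  set N := (l ++ [d]).sum with hN
  have hSl := Finset.sum_range_succ w l.length
  have hSc : ∑ i ∈ Finset.range l.length, c i = ∑ i ∈ Finset.range l.length, w i :=
    Finset.sum_congr rfl fun i hi => hcl i (Finset.mem_range.1 hi)
  have hSc' : ∑ i ∈ Finset.range l.length, c' i = ∑ i ∈ Finset.range l.length, w i :=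
    Finset.sum_congr rfl fun i hi => hcl' i (Finset.mem_range.1 hi)
  have htc : turnOf c N = blockTurn l.length :=
    turnOf_eq (by omega) (by rw [Finset.sum_range_succ]; omega)
  have htc' : turnOf c' N = blockTurn (l.length + 1) :=
    turnOf_eq (by rw [Finset.sum_range_succ]; omega)
      (by rw [Finset.sum_range_succ, Finset.sum_range_succ]; omega)
  have hag : ∀ n ≤ N, pathMatrix c n = pathMatrix w n := fun n hn =>
    pathMatrix_eq_of_agree hcl (by omega) (by omega)
  have hag' : ∀ n ≤ N, pathMatrix c' n = pathMatrix w n := fun n hn =>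
    pathMatrix_eq_of_agree hcl' (by omega) (by omega)
  have hp := hα.points R.irrational hc
  have hp' := hα'.points R.irrational' hc'
  have hpath : ∀ n ≤ N, path c n = path c' n := fun n hn => by
    unfold path; rw [hag n hn, hag' n hn]
  refine R.approachIs (path_zero c) (toward_path hp) ⟨fun n hn => ?_, ?_⟩
    fun n hn => by unfold path; rw [hag n hn]
  · rw [hpath n (by omega), hpath (n + 1) (by omega)]
    exact toward_path hp' n
  -- Otherwise two different turns after the same edge would both point to α'.
  · refine (toward_or R.irrational' (toward_path hp N).1).resolve_left fun ht => ?_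
    have h1 : Points (pathMatrix c N * (turnOf c N).mat) α' := toward_turn_iff.1 ht
    have h2 : Points (pathMatrix c N * (turnOf c' N).mat) α' := by
      have := hp' (N + 1)
      rwa [pathMatrix, hag' N le_rfl, ← hag N le_rfl] at this
    have h3 := points_turn_unique h1 h2
    rw [htc, htc', blockTurn_succ] at h3
    exact (blockTurn l.length).flip_ne h3.symm

/-- The approach is empty if the two ends have different signs. -/
lemma ConjugateRoots.approachIs_nil {a h b : ℤ} {α α' : ℝ} (R : ConjugateRoots a h b α α')
    (hα : 0 < α) (hα' : α' < 0) : ApproachIs a h b [] := by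
  have hmem : initialVertex ∈ (river a h b).support := by
    -- The edge between 1/0 and 0/1 separates the positive from the negative ends.
    refine (SimpleGraph.mem_support _).2 ⟨vertex (1 * reverseMat), SimpleGraph.Adj.symm ?_⟩
    refine R.river_adj_iff.2 (Or.inl ⟨?_, ?_⟩)
    · refine toward_reverse_iff.2 ?_
      simpa [Points, act_one, linForm] using hα
    · refine toward_from_iff.2 (points_reverse_iff.2 ?_)
      simpa [act_one, linForm] using hα'
  refine ⟨⟨initialVertex, .nil, ⟨.nil, hmem, by simp⟩, rfl, ?_⟩, ?_⟩
  · intro n hn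
    obtain rfl : n = 0 := by simpa using hn
    rfl
  · rintro S p ⟨hp, -, hlast⟩
    obtain rfl := hlast _ p.start_mem_support hmem
    obtain rfl := (SimpleGraph.Walk.isPath_iff_nil.1 hp).eq_nil
    refine ⟨rfl, fun n hn => ?_⟩
    obtain rfl : n = 0 := by simpa using hn
    rfl

/-! ### Lagrange's theorem -/

/-- The complete quotients of the regular continued fraction. -/
def completeQuotient (α : ℝ) : ℕ → ℝ
  | 0 => α
  | n + 1 => 1 / (completeQuotient α n - ⌊completeQuotient α n⌋₊)

lemma irrational_completeQuotient {α : ℝ} (hα : Irrational α) (n : ℕ) :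
    Irrational (completeQuotient α n) := by
  induction n with
  | zero => exact hα
  | succ n ih =>
    rw [completeQuotient, one_div]
    exact (ih.sub_natCast _).inv

lemma completeQuotient_succ_gt {α : ℝ} (hα : Irrational α) {n : ℕ}
    (hn : 0 < completeQuotient α n) : 1 < completeQuotient α (n + 1) := by
  have h1 := Nat.floor_le hn.le
  have h2 := Nat.lt_floor_add_one (completeQuotient α n)
  have h3 := ((irrational_completeQuotient hα n).sub_natCast ⌊completeQuotient α n⌋₊).ne_zero
  have h4 : 0 < completeQuotient α n - ⌊completeQuotient α n⌋₊ :=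
    lt_of_le_of_ne (sub_nonneg.2 h1) h3.symm
  rw [completeQuotient, lt_div_iff₀ h4]
  linarith

lemma completeQuotient_pos {α : ℝ} (hα : Irrational α) (hpos : 0 < α) (n : ℕ) :
    0 < completeQuotient α n := by
  induction n with
  | zero => exact hpos
  | succ n ih => exact one_pos.trans (completeQuotient_succ_gt hα ih)

lemma form_discriminant (a h b : ℤ) (v w : ℤ × ℤ) :
    (form a h b (v + w) - form a h b v - form a h b w) ^ 2 - 4 * form a h b v * form a h b w =
      (h ^ 2 - 4 * a * b) * (v.1 * w.2 - v.2 * w.1) ^ 2 := by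
  simp only [form, Prod.fst_add, Prod.snd_add]
  ring

lemma ConjugateRoots.quot_root {a h b : ℤ} {α α' : ℝ} (R : ConjugateRoots a h b α α')
    (M : SL(2, ℤ)) (t : Turn) :
    (form a h b (act M t.kept) : ℝ) * quot α M t ^ 2 +
      ((form a h b (act M t.kept + act M t.flip.kept) - form a h b (act M t.kept) -
        form a h b (act M t.flip.kept) : ℤ) : ℝ) * quot α M t +
      form a h b (act M t.flip.kept) = 0 := by
  have h0 := linForm_act_ne_zero R.irrational M t.kept_ne_zero
  push_cast
  rw [R.form_eq, R.form_eq, R.form_eq, linForm_add, linForm_add]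
  unfold quot
  field_simp
  ring

lemma det_kept (M : SL(2, ℤ)) (t : Turn) :
    ((act M t.kept).1 * (act M t.flip.kept).2 - (act M t.kept).2 * (act M t.flip.kept).1) ^ 2 =
      1 := by
  have := det_eq M
  cases t
  · simp only [act, Turn.kept, Turn.flip]
    linear_combination (M 0 0 * M 1 1 - M 0 1 * M 1 0 + 1) * this
  · simp only [act, Turn.kept, Turn.flip]
    linear_combination (M 0 0 * M 1 1 - M 0 1 * M 1 0 + 1) * this

/-- Since K O < 0, the discriminant is a sum of the two nonnegative terms H ^ 2 and -4 K O, and each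
coefficient is bounded by it. -/
lemma abs_le_of_discriminant {K H O D : ℤ} (hD : H ^ 2 - 4 * K * O = D) (hneg : K * O < 0) :
    (K, H, O) ∈ Set.Icc (-D) D ×ˢ Set.Icc (-D) D ×ˢ Set.Icc (-D) D := by
  have hK : |K| ≤ D := by
    rcases mul_neg_iff.1 hneg with ⟨h1, h2⟩ | ⟨h1, h2⟩
    · rw [abs_of_pos h1]; nlinarith [sq_nonneg H]
    · rw [abs_of_neg h1]; nlinarith [sq_nonneg H]
  have hO : |O| ≤ D := by
    rcases mul_neg_iff.1 hneg with ⟨h1, h2⟩ | ⟨h1, h2⟩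
    · rw [abs_of_neg h2]; nlinarith [sq_nonneg H]
    · rw [abs_of_pos h2]; nlinarith [sq_nonneg H]
  have hH : |H| ≤ D := by
    have := Int.le_self_sq |H|
    rw [sq_abs] at this
    linarith
  rw [abs_le] at hK hO hH
  exact ⟨hK, hH, hO⟩

/-- From some block on the path is on the river, where the form in the basis of the edge has outer
coefficients of opposite signs and the fixed discriminant. Finitely many forms are possible, each
has one positive root, and that root is the complete quotient. -/
lemma ConjugateRoots.exists_completeQuotient_eq {a h b : ℤ} {α α' : ℝ}
    (R : ConjugateRoots a h b α α') (hpos : 0 < α) :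
    ∃ m n, m < n ∧ completeQuotient α m = completeQuotient α n := by
  have hα := R.irrational
  set c : ℕ → ℕ := fun n => ⌊completeQuotient α n⌋₊ with hc
  have hq : ∀ n, completeQuotient α n = c n + 1 / completeQuotient α (n + 1) := by
    intro n
    simp [completeQuotient, hc]
  have hquot := quot_blockMatrix (c := c) hα (q := completeQuotient α) rfl hq
  have hge : ∀ n, 1 ≤ c (n + 1) := fun n =>
    Nat.le_floor (by exact_mod_cast
      (completeQuotient_succ_gt hα (completeQuotient_pos hα hpos n)).le)
  have hsum : ∀ n, n ≤ ∑ i ∈ Finset.range (n + 1), c i := by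
    intro n
    induction n with
    | zero => exact Nat.zero_le _
    | succ n ih =>
      rw [Finset.sum_range_succ]
      have := hge n
      omega
  have hinf : InfinitelyManyTurns c := fun n => ⟨n + 2, hsum (n + 1)⟩
  have hp : ∀ n, Points (pathMatrix c n) α :=
    HasQuotients.points hα hinf
      ⟨completeQuotient α, rfl, fun n => ⟨completeQuotient_pos hα hpos n, hq n⟩⟩
  obtain ⟨N, hN⟩ : ∃ N, ¬ Points (pathMatrix c N) α' := by
    by_contra! hall
    exact R.ne ((leadsTo_of_toward hα (toward_path hp)).unique
      (leadsTo_of_toward R.irrational' (toward_path hall)))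
  have hN' : ∀ n, N ≤ n → ¬ Points (pathMatrix c n) α' := by
    intro n hn
    induction n, hn using Nat.le_induction with
    | base => exact hN
    | succ n hn ih => exact fun h => ih (Points.of_turn h)
  -- The entry `c 0` may vanish, so N + 1 blocks are needed to guarantee N turns.
  have hneg : ∀ n, form a h b (act (blockMatrix c (N + 1 + n)) (blockTurn (N + 1 + n)).kept) *
      form a h b (act (blockMatrix c (N + 1 + n)) (blockTurn (N + 1 + n)).flip.kept) < 0 := by
    intro n
    have h1 := (R.form_mul_form_neg_iff (blockMatrix c (N + 1 + n))).2 (Or.inl ⟨hp _, hN' _ (by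
      have := hsum (N + n)
      rw [show N + n + 1 = N + 1 + n by omega] at this
      omega)⟩)
    cases blockTurn (N + 1 + n)
    · exact h1
    · rw [mul_comm]; exact h1
  set F : ℕ → ℤ × ℤ × ℤ := fun n =>
    (form a h b (act (blockMatrix c (N + 1 + n)) (blockTurn (N + 1 + n)).kept),
      form a h b (act (blockMatrix c (N + 1 + n)) (blockTurn (N + 1 + n)).kept +
        act (blockMatrix c (N + 1 + n)) (blockTurn (N + 1 + n)).flip.kept) -
      form a h b (act (blockMatrix c (N + 1 + n)) (blockTurn (N + 1 + n)).kept) -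
      form a h b (act (blockMatrix c (N + 1 + n)) (blockTurn (N + 1 + n)).flip.kept),
      form a h b (act (blockMatrix c (N + 1 + n)) (blockTurn (N + 1 + n)).flip.kept)) with hF
  set D := h ^ 2 - 4 * a * b
  have hmaps : Set.MapsTo F Set.univ (Set.Icc (-D) D ×ˢ Set.Icc (-D) D ×ˢ Set.Icc (-D) D) := by
    intro n _
    refine abs_le_of_discriminant ?_ (hneg n)
    rw [form_discriminant, det_kept, mul_one]
  obtain ⟨m, -, n, -, hmn, heq⟩ := Set.infinite_univ.exists_ne_map_eq_of_mapsTo hmaps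
    ((Set.finite_Icc _ _).prod ((Set.finite_Icc _ _).prod (Set.finite_Icc _ _)))
  have hroot : ∀ k, ((F k).1 : ℝ) * completeQuotient α (N + 1 + k) ^ 2 +
      ((F k).2.1 : ℝ) * completeQuotient α (N + 1 + k) + ((F k).2.2 : ℝ) = 0 := by
    intro k
    rw [← hquot]
    exact R.quot_root _ _
  have hx : completeQuotient α (N + 1 + m) = completeQuotient α (N + 1 + n) := by
    have e1 := hroot m
    have e2 := hroot n
    rw [← heq] at e2
    have h1 := completeQuotient_pos hα hpos (N + 1 + m)
    have h2 := completeQuotient_pos hα hpos (N + 1 + n)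
    have h3 : ((F m).1 : ℝ) * (F m).2.2 < 0 := by exact_mod_cast hneg m
    generalize completeQuotient α (N + 1 + m) = x at *
    generalize completeQuotient α (N + 1 + n) = y at *
    generalize ((F m).1 : ℝ) = A at *
    generalize ((F m).2.1 : ℝ) = H at *
    generalize ((F m).2.2 : ℝ) = B at *
    -- Two distinct positive roots would have the positive product B / A, against A * B < 0.
    by_contra hne
    have e3 : (x - y) * (A * x * y - B) = 0 := by linear_combination y * e1 - x * e2
    have e4 : A * x * y = B := by
      rcases mul_eq_zero.1 e3 with h | h
      · exact absurd (sub_eq_zero.1 h) hne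
      · linarith
    rw [← e4] at h3
    nlinarith [mul_nonneg (sq_nonneg A) (mul_pos h1 h2).le]
  rcases lt_or_gt_of_ne hmn with h | h
  · exact ⟨_, _, by omega, hx⟩
  · exact ⟨_, _, by omega, hx.symm⟩

lemma ConjugateRoots.exists_isPeriodicExpansion {a h b : ℤ} {α α' : ℝ}
    (R : ConjugateRoots a h b α α') (hpos : 0 < α) :
    ∃ pre per : List ℕ, IsPeriodicExpansion pre per α := by
  classical
  have hα := R.irrational
  obtain ⟨m, n, hmn, heq⟩ := R.exists_completeQuotient_eq hpos
  set c : ℕ → ℕ := fun n => ⌊completeQuotient α n⌋₊ with hc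
  have hge : ∀ n, 1 ≤ c (n + 1) := fun n =>
    Nat.le_floor (by exact_mod_cast
      (completeQuotient_succ_gt hα (completeQuotient_pos hα hpos n)).le)
  have hshift : ∀ k, completeQuotient α (m + k) = completeQuotient α (n + k) := by
    intro k
    induction k with
    | zero => exact heq
    | succ k ih => rw [← add_assoc, ← add_assoc, completeQuotient, completeQuotient, ih]
  -- The least start of periodicity is used: if the preperiod and the period ended in the same
  -- entry, periodicity would start one place earlier.
  have hex : ∃ N, ∃ l, 0 < l ∧ ∀ k, N ≤ k → c (k + l) = c k := by
    refine ⟨m, n - m, by omega, fun k hk => ?_⟩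
    have := hshift (k - m)
    rw [show m + (k - m) = k by omega, show n + (k - m) = k + (n - m) by omega] at this
    simp only [hc, this]
  obtain ⟨l, hl, hper⟩ := Nat.find_spec hex
  set N := Nat.find hex with hN
  have hperiodic : Function.Periodic (fun k => c (N + k)) l := fun k => by
    simp only [← add_assoc]
    exact hper _ (by omega)
  set pre := (List.range N).map c with hpre
  set per := (List.range l).map (fun i => c (N + i)) with hperdef
  have hseq : periodicSeq pre per = c := by
    funext k
    unfold periodicSeq
    have h1 : pre.length = N := by simp [hpre]
    have h2 : per.length = l := by simp [hperdef]
    rw [h1, h2]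
    split_ifs with hk
    · rw [List.getD_eq_getElem _ _ (by omega)]
      simp [hpre]
    · have hlt := Nat.mod_lt (k - N) hl
      rw [List.getD_eq_getElem _ _ (by omega)]
      simp only [hperdef, List.getElem_map, List.getElem_range]
      exact (hperiodic.map_mod_nat (k - N)).trans (congrArg c (by omega))
  have hne : per ≠ [] := by
    rw [← List.length_pos_iff]; simpa [hperdef] using hl
  have hone : ∀ x ∈ per, 1 ≤ x := by
    intro x hx
    simp only [hperdef, List.mem_map, List.mem_range] at hx
    obtain ⟨i, -, rfl⟩ := hx
    -- Only `c 0` could vanish; if it belongs to the period, it equals the later entry `c l`.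
    rcases Nat.eq_zero_or_pos (N + i) with h0 | h0
    · rw [← hper _ (by omega), h0, zero_add, show l = l - 1 + 1 by omega]
      exact hge _
    · rw [show N + i = N + i - 1 + 1 by omega]
      exact hge _
  refine ⟨pre, per, hne, hone, ?_, ?_, ?_⟩
  · intro x hx
    rw [hpre, ← List.map_tail] at hx
    obtain ⟨i, hi, rfl⟩ := List.mem_map.1 hx
    have hi' : 1 ≤ i := by simp at hi; omega
    rw [show i = i - 1 + 1 by omega]
    exact hge _
  · intro hlast
    have hl' : per.getLast? = some (c (N + (l - 1))) := by
      rw [hperdef, show l = l - 1 + 1 by omega, List.range_succ]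
      simp
    rw [hl'] at hlast
    rcases Nat.eq_zero_or_pos N with h0 | h0
    · rw [hpre, h0] at hlast
      simp at hlast
    · have hp' : pre.getLast? = some (c (N - 1)) := by
        rw [hpre]
        conv_lhs => rw [show N = N - 1 + 1 by omega, List.range_succ]
        simp
      rw [hp', Option.some_inj] at hlast
      refine Nat.find_min hex (show N - 1 < Nat.find hex by omega) ⟨l, hl, fun k hk => ?_⟩
      rcases hk.lt_or_eq with hlt | rfl
      · exact hper k (by omega)
      · rw [hlast]; congr 1; omega
  · have hinf := infinitelyManyTurns_periodicSeq pre hne hone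
    refine hasContFrac_of_points hα hinf (HasQuotients.points hα hinf ?_)
    rw [hseq]
    exact ⟨completeQuotient α, rfl, fun n => ⟨completeQuotient_pos hα hpos n, by
      simp [completeQuotient, hc]⟩⟩

/-! ### The course of the river -/

/-- Serves both for the block starts and for the edge matrices of the river: invertible steps let
the recursion run to negative indices. -/
lemma exists_int_orbit {X : Type*} (e : ℤ → Equiv.Perm X) (x : X) :
    ∃ B : ℤ → X, B 0 = x ∧ ∀ n, B (n + 1) = e n (B n) := by
  let P : ℕ → X := fun n => Nat.rec x (fun n y => e n y) n
  let Q : ℕ → X := fun n => Nat.rec x (fun n y => (e (-(n + 1 : ℕ))).symm y) n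
  refine ⟨fun n => Int.casesOn n P fun n => Q (n + 1), rfl, fun n => ?_⟩
  rcases n with n | n
  · rfl
  · rcases n with _ | n
    · exact ((e (-1)).apply_symm_apply x).symm
    · have h1 : Int.negSucc (n + 1) + 1 = Int.negSucc n := by omega
      have h2 : Int.negSucc (n + 1) = -((n + 1 + 1 : ℕ) : ℤ) := by omega
      rw [h1, h2]
      exact ((e (-((n + 1 + 1 : ℕ) : ℤ))).apply_symm_apply (Q (n + 1))).symm

/-- The entry with the number `j` in the bi-infinite repetition of the period. -/
def periodEntry (per : List ℕ) (j : ℤ) : ℕ := per.getD (j % (per.length : ℤ)).toNat 0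

/-- The complete quotients in the bi-infinite repetition of the period. -/
def periodQuotient (per : List ℕ) (t : ℝ) (j : ℤ) : ℝ :=
  cfEval (per.drop (j % (per.length : ℤ)).toNat) t

lemma toNat_emod_lt {l : ℕ} (hl : 0 < l) (j : ℤ) : (j % (l : ℤ)).toNat < l := by
  have h1 := Int.emod_nonneg j (show (l : ℤ) ≠ 0 by omega)
  have h2 := Int.emod_lt_of_pos j (show (0 : ℤ) < l by omega)
  omega

lemma periodEntry_pos {per : List ℕ} (hne : per ≠ []) (hper : ∀ x ∈ per, 1 ≤ x) (j : ℤ) :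
    1 ≤ periodEntry per j := by
  have hlt := toNat_emod_lt (List.length_pos_iff.2 hne) j
  rw [periodEntry, List.getD_eq_getElem _ _ hlt]
  exact hper _ (List.getElem_mem hlt)

lemma periodQuotient_eq {per : List ℕ} (hne : per ≠ []) {t : ℝ} (hfix : cfEval per t = t)
    (j : ℤ) : periodQuotient per t j =
      periodEntry per j + 1 / periodQuotient per t (j + 1) := by
  have hl := List.length_pos_iff.2 hne
  have hlt := toNat_emod_lt hl j
  unfold periodQuotient periodEntry
  rw [List.drop_eq_getElem_cons hlt, cfEval_cons, List.getD_eq_getElem _ _ hlt]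
  congr 2
  have h1 := Int.emod_nonneg j (show (per.length : ℤ) ≠ 0 by omega)
  rcases Nat.lt_or_ge ((j % (per.length : ℤ)).toNat + 1) per.length with h | h
  · have : (j + 1) % (per.length : ℤ) = j % (per.length : ℤ) + 1 := by
      rw [← Int.emod_add_emod]
      exact Int.emod_eq_of_lt (by omega) (by omega)
    rw [this, Int.toNat_add h1 (by omega)]
    rfl
  · have h2 : j % (per.length : ℤ) + 1 = per.length := by omega
    have : (j + 1) % (per.length : ℤ) = 0 := by
      rw [← Int.emod_add_emod, h2, Int.emod_self]
    rw [this, show (j % (per.length : ℤ)).toNat + 1 = per.length by omega, List.drop_length,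
      Int.toNat_zero, List.drop_zero, hfix, cfEval_nil]

lemma periodQuotient_zero {per : List ℕ} {t : ℝ} (hfix : cfEval per t = t) :
    periodQuotient per t 0 = t := by
  simp [periodQuotient, hfix]

lemma periodQuotient_neg {per : List ℕ} (hne : per ≠ []) {t : ℝ} (ht : t < 0)
    (hfix : cfEval per t = t) (j : ℤ) : periodQuotient per t j < 0 := by
  have key : ∀ i ≤ per.length, cfEval (per.drop i) t < 0 := by
    intro i
    induction i with
    | zero => intro _; rwa [List.drop_zero, hfix]
    | succ i ih =>
      intro hi
      have := ih (by omega)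
      rw [List.drop_eq_getElem_cons (by omega), cfEval_cons] at this
      have h0 : (0 : ℝ) ≤ per[i] := Nat.cast_nonneg _
      exact one_div_neg.1 (by linarith)
  exact key _ (toNat_emod_lt (List.length_pos_iff.2 hne) j).le

lemma sum_range_periodicSeq (pre per : List ℕ) :
    ∑ i ∈ Finset.range pre.length, periodicSeq pre per i = pre.sum := by
  rw [← sum_range_getD]
  refine Finset.sum_congr rfl fun i hi => ?_
  have := periodicSeq_append_lt pre [] per (Finset.mem_range.1 hi)
  rwa [List.append_nil] at this

lemma quot_blockMatrix_pre {ξ t : ℝ} (hξ : Irrational ξ) {pre : List ℕ} (per : List ℕ)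
    (h : ξ = cfEval pre t) :
    quot ξ (blockMatrix (periodicSeq pre per) pre.length) (blockTurn pre.length) = t := by
  have key : ∀ j ≤ pre.length, quot ξ (blockMatrix (periodicSeq pre per) j) (blockTurn j) =
      cfEval (pre.drop j) t := by
    intro j
    induction j with
    | zero => intro _; rw [quot_blockMatrix_zero, List.drop_zero, h]
    | succ j ih =>
      intro hj
      rw [quot_blockMatrix_succ hξ, ih (by omega), List.drop_eq_getElem_cons (by omega),
        cfEval_cons]
      have e : periodicSeq pre per j = pre[j] := by
        rw [periodicSeq, if_pos (by omega), List.getD_eq_getElem]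
      rw [e]
      simp
  rw [key _ le_rfl, List.drop_length, cfEval_nil]

/-- The orbits towards an end merge. -/
lemma exists_merge {ξ : ℝ} (hξ : Irrational ξ) {f : Superbase → Superbase}
    (hf : ∀ S, Toward ξ S (f S)) {S T : Superbase} (h : topograph.Reachable S T) :
    ∃ i m : ℕ, f^[i] S = f^[m] T := by
  obtain ⟨p⟩ := h
  induction p with
  | nil => exact ⟨0, 0, rfl⟩
  | @cons u v w hadj p ih =>
    obtain ⟨i, m, him⟩ := ih
    rcases toward_or hξ hadj with h | h
    · exact ⟨i + 1, m, by rw [Function.iterate_succ_apply, (hf u).unique h, him]⟩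
    · refine ⟨i, m + 1, ?_⟩
      rw [(hf v).unique h |>.symm, ← Function.iterate_succ_apply, Function.iterate_succ_apply',
        Function.iterate_succ_apply', him]

lemma exists_toward {ξ : ℝ} (hξ : Irrational ξ) (S : Superbase) : ∃ T, Toward ξ S T := by
  obtain ⟨M, rfl⟩ := exists_vertex_eq S
  rcases points_or_reverse hξ M with h | h
  · obtain ⟨t, ht⟩ := h.exists_turn hξ
    exact ⟨_, toward_turn_iff.2 ht⟩
  · exact ⟨_, toward_from_iff.2 h⟩

/-- A bi-infinite path from one end to the other is the whole river. -/
lemma ConjugateRoots.river_adj_iff_of_line {a h b : ℤ} {α α' : ℝ}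
    (R : ConjugateRoots a h b α α') {γ : ℤ → Superbase}
    (h1 : ∀ n, Toward α (γ n) (γ (n + 1))) (h2 : ∀ n, Toward α' (γ (n + 1)) (γ n))
    (S T : Superbase) : (river a h b).Adj S T ↔
      ∃ n, (S = γ n ∧ T = γ (n + 1)) ∨ (T = γ n ∧ S = γ (n + 1)) := by
  choose f hf using exists_toward R.irrational
  have hγ : ∀ m : ℕ, f^[m] (γ 0) = γ m := by
    intro m
    induction m with
    | zero => rfl
    | succ m ih =>
      rw [Function.iterate_succ_apply', ih]
      exact (hf _).unique (by exact_mod_cast h1 m)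
  have h2' : ∀ n, Toward α' (γ n) (γ (n - 1)) := fun n => by
    have := h2 (n - 1)
    rwa [sub_add_cancel] at this
  -- The flow to α carries `T` onto γ in i steps; from there the edges are recovered backwards, as
  -- the only ones that descend to α'.
  have back : ∀ (i : ℕ) (S T : Superbase) (m : ℤ), Toward α S T → Toward α' T S →
      f^[i] T = γ m → ∃ n, S = γ n ∧ T = γ (n + 1) := by
    intro i
    induction i with
    | zero =>
      intro S T m _ hTS hT
      replace hT : T = γ m := hT
      rw [hT] at hTS
      exact ⟨m - 1, hTS.unique (h2' m), by rw [hT, sub_add_cancel]⟩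
    | succ i ih =>
      intro S T m hST hTS hT
      have hriv : Toward α' (f T) T := by
        refine (toward_or R.irrational' (hf T).1).resolve_left fun hc => ?_
        have hfT := hf T
        rw [hc.unique hTS] at hfT
        exact hST.not_symm hfT
      rw [Function.iterate_succ_apply] at hT
      obtain ⟨n, hn, -⟩ := ih T (f T) m (hf T) hriv hT
      rw [hn] at hTS
      exact ⟨n - 1, hTS.unique (h2' n), by rw [hn, sub_add_cancel]⟩
  have forw : ∀ S T : Superbase, Toward α S T → Toward α' T S →
      ∃ n, S = γ n ∧ T = γ (n + 1) := by
    intro S T hST hTS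
    obtain ⟨i, m, him⟩ := exists_merge R.irrational hf
      ((topograph_reachable T).trans (topograph_reachable (γ 0)).symm)
    rw [hγ] at him
    exact back i S T m hST hTS him
  rw [R.river_adj_iff]
  constructor
  · rintro (⟨h3, h4⟩ | ⟨h3, h4⟩)
    · obtain ⟨n, hn⟩ := forw S T h3 h4
      exact ⟨n, Or.inl hn⟩
    · obtain ⟨n, hn⟩ := forw T S h4 h3
      exact ⟨n, Or.inr hn⟩
  · rintro ⟨n, ⟨rfl, rfl⟩ | ⟨rfl, rfl⟩⟩
    · exact Or.inl ⟨h1 n, h2 n⟩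
    · exact Or.inr ⟨h2 n, h1 n⟩

lemma exists_block_int {s : ℤ → ℤ} (h0 : s 0 = 0) (hs : StrictMono s) (n : ℤ) :
    ∃ j, s j ≤ n ∧ n < s (j + 1) := by
  induction n using Int.induction_on with
  | zero => exact ⟨0, h0.le, by rw [← h0]; exact hs (by omega)⟩
  | succ n ih =>
    obtain ⟨j, h1, h2⟩ := ih
    rcases lt_or_ge ((n : ℤ) + 1) (s (j + 1)) with h | h
    · exact ⟨j, by omega, h⟩
    · have := hs (show j + 1 < j + 1 + 1 by omega)
      exact ⟨j + 1, h, by omega⟩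
  | pred n ih =>
    obtain ⟨j, h1, h2⟩ := ih
    rcases lt_or_ge (-(n : ℤ) - 1) (s j) with h | h
    · have := hs (show j - 1 < j by omega)
      exact ⟨j - 1, by omega, by rwa [sub_add_cancel]⟩
    · exact ⟨j, h, by omega⟩

lemma block_int_unique {s : ℤ → ℤ} (hs : StrictMono s) {n i j : ℤ} (hi : s i ≤ n)
    (hi' : n < s (i + 1)) (hj : s j ≤ n) (hj' : n < s (j + 1)) : i = j := by
  have h1 := hs.lt_iff_lt.1 (hi.trans_lt hj')
  have h2 := hs.lt_iff_lt.1 (hj.trans_lt hi')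
  omega

/-- The turn of the block with number `j` in a bi-infinite path. -/
def intBlockTurn (first : Turn) (j : ℤ) : Turn := if Even j then first else first.flip

lemma intBlockTurn_succ (first : Turn) (j : ℤ) :
    intBlockTurn first (j + 1) = (intBlockTurn first j).flip := by
  unfold intBlockTurn
  by_cases hj : Even j <;> simp [hj, Turn.flip_flip]

lemma blockTurn_add (k j : ℕ) : blockTurn (k + j) = intBlockTurn (blockTurn k) j := by
  induction j with
  | zero => simp [intBlockTurn]
  | succ j ih => rw [← add_assoc, blockTurn_succ, ih, Nat.cast_succ, intBlockTurn_succ]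

/-- The complete quotients at the blocks of a bi-infinite path. -/
lemma quot_int_block {ξ : ℝ} (hξ : Irrational ξ) {f : ℤ → ℕ} {s : ℤ → ℤ} {first : Turn}
    {B : ℤ → SL(2, ℤ)} {τ : ℤ → Turn} {y : ℤ → ℝ} (h0 : s 0 = 0)
    (hs : ∀ j, s (j + 1) = s j + f j)
    (hτ : ∀ j n, s j ≤ n → n < s (j + 1) → τ n = intBlockTurn first j)
    (hB : ∀ n, B (n + 1) = B n * (τ n).mat) (hy : ∀ j, y j = f j + 1 / y (j + 1))
    (hy0 : quot ξ (B 0) first = y 0) (j : ℤ) {r : ℕ} (hr : r ≤ f j) :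
    quot ξ (B (s j + r)) (intBlockTurn first j) = y j - r := by
  have hpow : ∀ j, ∀ r : ℕ, r ≤ f j →
      B (s j + r) = B (s j) * (intBlockTurn first j).mat ^ r := by
    intro j r
    induction r with
    | zero => intro _; simp
    | succ r ih =>
      intro hr
      have := hs j
      rw [Nat.cast_succ, ← add_assoc, hB, ih (by omega), hτ j _ (by omega) (by omega), pow_succ,
        mul_assoc]
  have hnext : ∀ j, quot ξ (B (s (j + 1))) (intBlockTurn first (j + 1)) =
      (quot ξ (B (s j)) (intBlockTurn first j) - f j)⁻¹ := by
    intro j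
    rw [hs, hpow j _ le_rfl, intBlockTurn_succ, quot_flip, quot_mul_turn_pow hξ]
  have hstart : ∀ j, quot ξ (B (s j)) (intBlockTurn first j) = y j := by
    intro j
    induction j using Int.induction_on with
    | zero => rw [h0]; simpa [intBlockTurn] using hy0
    | succ j ih => rw [hnext, ih, hy j]; simp
    | pred j ih =>
      have := hnext (-(j : ℤ) - 1)
      rw [sub_add_cancel, ih] at this
      rw [hy, sub_add_cancel, this]
      simp
  rw [hpow j r hr, quot_mul_turn_pow hξ, hstart]

lemma LeadsTo.int_atTop {γ : ℤ → Superbase} {ξ : ℝ} (h : LeadsTo (fun n : ℕ => γ n) atTop ξ) :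
    LeadsTo γ atTop ξ := by
  intro ε hε
  obtain ⟨N, hN⟩ := eventually_atTop.1 (h ε hε)
  refine eventually_atTop.2 ⟨N, fun n hn => ?_⟩
  have := hN n.toNat (by omega)
  simp only [Int.toNat_of_nonneg (show 0 ≤ n by omega)] at this
  exact this

lemma LeadsTo.int_atBot {γ : ℤ → Superbase} {ξ : ℝ}
    (h : LeadsTo (fun n : ℕ => γ (-(n : ℤ))) atTop ξ) : LeadsTo γ atBot ξ := by
  intro ε hε
  obtain ⟨N, hN⟩ := eventually_atTop.1 (h ε hε)
  refine eventually_atBot.2 ⟨-(N : ℤ), fun n hn => ?_⟩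
  have := hN (-n).toNat (by omega)
  simp only [Int.toNat_of_nonneg (show 0 ≤ -n by omega), neg_neg] at this
  exact this

/-- The turns are continued periodically in both directions from the end of the preperiod. Along
this line the quotients of α and α' obey the same periodic recursion, started at β > 0 and at β' <
0, so every edge points to α and none to α'; such a line is the whole river. -/
lemma ConjugateRoots.riverIs {a h b : ℤ} {α α' : ℝ} (R : ConjugateRoots a h b α α')
    {pre per : List ℕ} (hne : per ≠ []) (hper : ∀ x ∈ per, 1 ≤ x) {β β' : ℝ} (hβ : 0 < β)
    (hβ' : β' < 0) (hα : α = cfEval pre β) (hα' : α' = cfEval pre β')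
    (hfix : cfEval per β = β) (hfix' : cfEval per β' = β') : RiverIs a h b pre per α' α := by
  set first := blockTurn pre.length with hfirst
  set c := periodicSeq pre per with hc
  have hinf : InfinitelyManyTurns c := infinitelyManyTurns_periodicSeq pre hne hper
  obtain ⟨s, hs0, hs⟩ := exists_int_orbit (fun j => Equiv.addRight (periodEntry per j : ℤ)) 0
  replace hs : ∀ j, s (j + 1) = s j + (periodEntry per j : ℤ) := hs
  have hmono : StrictMono s := strictMono_int_of_lt_succ fun j => by
    have := hs j
    have := periodEntry_pos hne hper j
    omega
  choose J hJ hJ' using exists_block_int hs0 hmono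
  set τ : ℤ → Turn := fun n => intBlockTurn first (J n) with hτdef
  have hτ : ∀ j n, s j ≤ n → n < s (j + 1) → τ n = intBlockTurn first j := by
    intro j n h1 h2
    rw [hτdef]
    simp only
    rw [block_int_unique hmono (hJ n) (hJ' n) h1 h2]
  obtain ⟨B, hB0, hB⟩ := exists_int_orbit (fun n => Equiv.mulRight (τ n).mat)
    (blockMatrix c pre.length)
  replace hB : ∀ n, B (n + 1) = B n * (τ n).mat := hB
  have hsum : ∀ j : ℕ, s j = ((∑ i ∈ Finset.range (pre.length + j), c i : ℕ) : ℤ) - pre.sum := by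
    intro j
    induction j with
    | zero => rw [Nat.cast_zero, hs0, add_zero, sum_range_periodicSeq]; simp
    | succ j ih =>
      rw [Nat.cast_succ, hs, ih, ← add_assoc, Finset.sum_range_succ]
      have : c (pre.length + j) = periodEntry per j := by
        rw [hc, periodicSeq, if_neg (by omega), periodEntry]
        congr 1
        rw [Nat.add_sub_cancel_left]
        norm_cast
      rw [this]
      push_cast
      ring
  have hBc : ∀ n : ℕ, B n = pathMatrix c (pre.sum + n) := by
    intro n
    induction n with
    | zero => rw [Nat.cast_zero, hB0, blockMatrix, sum_range_periodicSeq, add_zero]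
    | succ n ih =>
      rw [Nat.cast_succ, hB, ih, ← add_assoc, pathMatrix]
      congr 2
      obtain ⟨k, r, hkr, hr⟩ := hinf.exists_block (pre.sum + n)
      have hk : pre.length ≤ k := by
        by_contra hlt
        have h1 : ∑ i ∈ Finset.range (k + 1), c i ≤ ∑ i ∈ Finset.range pre.length, c i :=
          sum_range_mono c (by omega)
        rw [hc, sum_range_periodicSeq, ← hc, Finset.sum_range_succ] at h1
        omega
      obtain ⟨j, rfl⟩ := Nat.exists_eq_add_of_le hk
      have h1 := hsum j
      have h2 := hsum (j + 1)
      rw [Nat.cast_succ j, ← add_assoc, Finset.sum_range_succ] at h2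
      rw [turnOf_eq (j := pre.length + j) (by omega) (by rw [Finset.sum_range_succ]; omega),
        blockTurn_add]
      exact hτ j n (by omega) (by omega)
  have hquot : ∀ ξ t : ℝ, Irrational ξ → ξ = cfEval pre t → cfEval per t = t → ∀ n,
      ∃ j, ∃ r : ℕ, r < periodEntry per j ∧
        quot ξ (B n) (intBlockTurn first j) = periodQuotient per t j - r := by
    intro ξ t hξ hξt hfix n
    have h1 := hJ n
    have h2 := hJ' n
    rw [hs] at h2
    refine ⟨J n, (n - s (J n)).toNat, by omega, ?_⟩
    rw [← quot_int_block hξ hs0 hs hτ hB (periodQuotient_eq hne hfix)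
      (by rw [hB0, periodQuotient_zero hfix]; exact quot_blockMatrix_pre hξ per hξt) (J n)
      (r := (n - s (J n)).toNat) (by omega)]
    congr 2
    omega
  have hP : ∀ n, Points (B n) α := by
    intro n
    obtain ⟨j, r, hr, hq⟩ := hquot α β R.irrational hα hfix n
    rw [points_iff_quot_pos R.irrational _ (intBlockTurn first j), hq, periodQuotient_eq hne hfix]
    have h1 : (r : ℝ) < periodEntry per j := by exact_mod_cast hr
    have h2 : 0 < 1 / periodQuotient per β (j + 1) := one_div_pos.2 (cfEval_pos _ hβ)
    linarith
  have hP' : ∀ n, ¬ Points (B n) α' := by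
    intro n
    obtain ⟨j, r, -, hq⟩ := hquot α' β' R.irrational' hα' hfix' n
    rw [points_iff_quot_pos R.irrational' _ (intBlockTurn first j), hq, not_lt]
    have h1 : (0 : ℝ) ≤ r := Nat.cast_nonneg r
    have h2 := periodQuotient_neg hne hβ' hfix' j
    linarith
  have ht : ∀ n, Toward α (vertex (B n)) (vertex (B (n + 1))) := fun n => by
    have := hP (n + 1)
    rw [hB] at this ⊢
    exact toward_turn_iff.2 this
  have ht' : ∀ n, Toward α' (vertex (B (n + 1))) (vertex (B n)) := fun n => by
    have := toward_from_iff.2 ((not_points_iff R.irrational').1 (hP' (n + 1)))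
    rw [hB, vertex_mul_turn_reverse] at this
    rwa [hB]
  refine ⟨B, τ, ⟨s, hs0, hs, hτ⟩, hB, hBc, ?_, ?_, ?_, ?_⟩
  · have : StrictAnti fun n => weight α (vertex (B n)) :=
      strictAnti_int_of_succ_lt fun n => (ht n).2
    exact fun m n hmn => this.injective (congrArg (weight α) hmn)
  · exact R.river_adj_iff_of_line (γ := fun n => vertex (B n)) ht ht'
  · refine LeadsTo.int_atTop (leadsTo_of_toward R.irrational fun n => ?_)
    exact_mod_cast ht n
  · refine LeadsTo.int_atBot (leadsTo_of_toward R.irrational' fun n => ?_)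
    have := ht' (-((n + 1 : ℕ) : ℤ))
    rwa [show -((n + 1 : ℕ) : ℤ) + 1 = -(n : ℤ) by omega] at this

/-! ### The path to the conjugate root -/

lemma hasQuotients_append_nil {per : List ℕ} {t : ℝ} (l : List ℕ)
    (h : HasQuotients (periodicSeq [] per) t) :
    HasQuotients (periodicSeq l per) (cfEval l t) := by
  have := h.append l
  rwa [List.append_nil] at this

lemma HasQuotients.rotate_reverse {bs : List ℕ} {y : ℕ} {ξ : ℝ}
    (h : HasQuotients (periodicSeq [] (bs ++ [y]).reverse) ξ) :
    ∃ t, HasQuotients (periodicSeq [] (bs.reverse ++ [y])) t ∧ ξ = y + 1 / t := by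
  rw [List.reverse_append, List.reverse_singleton, List.singleton_append] at h
  exact h.rotate

/-- Rests on m - 1 / t = [m - 1, 1, t - 1]. Since 1 / β' = -(y + 1 / t), the last entry x
contributes (x - y) - 1 / t, and the expansion of t begins with c. -/
lemma hasQuotients_of_gt {as bs cs : List ℕ} {x y c : ℕ} {α' β' : ℝ}
    (hc : 1 ≤ c) (hyx : y < x) (hcs : y :: bs = cs ++ [c]) (hα' : α' = cfEval (as ++ [x]) β')
    (h : HasQuotients (periodicSeq [] (bs ++ [y]).reverse) (-(1 / β'))) :
    HasQuotients (periodicSeq (as ++ [x - y - 1, 1, c - 1]) (cs.reverse ++ [c])) α' := by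
  obtain ⟨t, ht, hrt⟩ := h.rotate_reverse
  have e : bs.reverse ++ [y] = c :: cs.reverse := by
    rw [← List.reverse_cons, hcs]; simp
  rw [e] at ht
  obtain ⟨u, hu, htu⟩ := ht.rotate
  have hupos := hu.pos
  convert hasQuotients_append_nil (as ++ [x - y - 1, 1, c - 1]) hu using 1
  rw [hα', cfEval_append, cfEval_append]
  congr 1
  obtain ⟨d, rfl⟩ := Nat.exists_eq_add_of_le hyx
  obtain ⟨c, rfl⟩ := Nat.exists_eq_add_of_le hc
  rw [show y.succ + d - y - 1 = d by omega, Nat.add_sub_cancel_left]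
  have hβ : 1 / β' = -(y + 1 / t) := by linarith
  simp only [cfEval_cons, cfEval_nil, hβ, htu]
  have h1 : (0 : ℝ) ≤ c := Nat.cast_nonneg c
  push_cast
  field_simp
  ring

/-- Here x + 1 / β' is -s with s = (y - x) + 1 / t > 0, so one unit is borrowed from the entry
before: w - 1 / s = [w - 1, 1, s - 1]. -/
lemma hasQuotients_of_lt {as bs : List ℕ} {w x y : ℕ} {α' β' : ℝ} (hxy : x < y) (hw : 1 ≤ w)
    (hα' : α' = cfEval (as ++ [w, x]) β')
    (h : HasQuotients (periodicSeq [] (bs ++ [y]).reverse) (-(1 / β'))) :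
    HasQuotients (periodicSeq (as ++ [w - 1, 1, y - x - 1]) (bs.reverse ++ [y])) α' := by
  obtain ⟨t, ht, hrt⟩ := h.rotate_reverse
  have htpos := ht.pos
  convert hasQuotients_append_nil (as ++ [w - 1, 1, y - x - 1]) ht using 1
  rw [hα', cfEval_append, cfEval_append]
  congr 1
  obtain ⟨d, rfl⟩ := Nat.exists_eq_add_of_le hxy
  obtain ⟨w, rfl⟩ := Nat.exists_eq_add_of_le hw
  rw [show x.succ + d - x - 1 = d by omega, Nat.add_sub_cancel_left]
  have hβ : 1 / β' = -(((x.succ + d : ℕ) : ℝ) + 1 / t) := by linarith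
  simp only [cfEval_cons, cfEval_nil, hβ]
  have h1 : (0 : ℝ) ≤ d := Nat.cast_nonneg d
  push_cast
  have e1 : (x : ℝ) + -(x + 1 + d + 1 / t) = -((1 + d) + 1 / t) := by ring
  have h2 : (1 + (d : ℝ)) + 1 / t ≠ 0 := by positivity
  rw [e1]
  field_simp
  ring

/-- For use when no positive entry before x is there to borrow from: the negative of the value is
expanded instead. -/
lemma hasQuotients_neg_of_lt {bs : List ℕ} {x y : ℕ} {β' : ℝ} (hxy : x ≤ y)
    (h : HasQuotients (periodicSeq [] (bs ++ [y]).reverse) (-(1 / β'))) :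
    HasQuotients (periodicSeq [y - x] (bs.reverse ++ [y])) (-(x + 1 / β')) := by
  obtain ⟨t, ht, hrt⟩ := h.rotate_reverse
  convert hasQuotients_append_nil [y - x] ht using 1
  rw [cfEval_cons, cfEval_nil, Nat.cast_sub hxy]
  linarith

lemma hasQuotients_zero_cons {pre per : List ℕ} {ξ : ℝ}
    (h : HasQuotients (periodicSeq pre per) (-ξ)) :
    HasQuotients (periodicSeq (0 :: pre) per) (-(1 / ξ)) := by
  have := h.append [0]
  simpa [div_neg] using this

end ConwayTopograph

end

/-! ### Assembly of the theorem -/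

open ConwayTopograph
theorem proposition3 (a h b : ℤ) (hindef : Indefinite a h b) (hzero : NotRepresentingZero a h b)
    (α α' : ℝ) (hα : (a : ℝ) * α ^ 2 + (h : ℝ) * α + (b : ℝ) = 0)
    (hα' : (a : ℝ) * α' ^ 2 + (h : ℝ) * α' + (b : ℝ) = 0) (hne : α' ≠ α)
    (hdom : |α'| ≤ |α|) (hpos : 0 < α) :
    (∃ pre per : List ℕ, IsPeriodicExpansion pre per α) ∧
    ∀ pre per : List ℕ, IsPeriodicExpansion pre per α →
      -- the path to `α`
      Describes a h b (periodicSeq pre per) α ∧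
      -- the river
      RiverIs a h b pre per α' α ∧
      -- `k ≥ 0` and `aₖ > bₗ`; here `c = bₗ₋₁`, read cyclically
      (∀ (as bs cs : List ℕ) (x y c : ℕ), pre = as ++ [x] → per = bs ++ [y] → y < x →
        y :: bs = cs ++ [c] →
          ApproachIs a h b (as ++ [x - y - 1]) ∧
          Describes a h b
            (periodicSeq (as ++ [x - y - 1, 1, c - 1]) (cs.reverse ++ [c])) α') ∧
      -- `k ≥ 1` and `aₖ < bₗ`
      (∀ (as bs : List ℕ) (w x y : ℕ), pre = as ++ [w, x] → per = bs ++ [y] → x < y →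
        (1 ≤ w →
          ApproachIs a h b (as ++ [w - 1]) ∧
          Describes a h b
            (periodicSeq (as ++ [w - 1, 1, y - x - 1]) (bs.reverse ++ [y])) α') ∧
        (w = 0 →
          as = [] ∧ a * b < 0 ∧ ApproachIs a h b [] ∧
          NegDescribes a h b (periodicSeq [0, y - x] (bs.reverse ++ [y])) α')) ∧
      -- `k = 0` and `a₀ < bₗ`
      (∀ (bs : List ℕ) (x y : ℕ), pre = [x] → per = bs ++ [y] → x < y →
          ApproachIs a h b [] ∧
          NegDescribes a h b (periodicSeq [y - x] (bs.reverse ++ [y])) α') ∧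
      -- the pure periodic expansions
      (pre = [] →
          ApproachIs a h b [] ∧
          NegDescribes a h b (periodicSeq [0] per.reverse) α') := by
  have R := exists_conjugateRoots hzero hα hα' hne
  refine ⟨R.exists_isPeriodicExpansion hpos, ?_⟩
  rintro pre per ⟨hper0, hper, htail, -, hcf⟩
  have hinf := infinitelyManyTurns_periodicSeq pre hper0 hper
  have hq := hcf.hasQuotients R.irrational hinf
  obtain ⟨β, β', -, hβ, hβ', hαβ, hαβ', hfix, hfix', hrev⟩ :=
    exists_periodic_part ⟨a, h, b, R⟩ hper0 hper hq
  have hreverse : ∀ (l bs : List ℕ) (y : ℕ), per = bs ++ [y] →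
      InfinitelyManyTurns (periodicSeq l (bs.reverse ++ [y])) := by
    rintro l bs y rfl
    exact infinitelyManyTurns_periodicSeq l (by simp) fun z hz => hper z (by simpa using hz)
  -- Positive quotients for -α' make α' negative; the initial edge then separates the two ends, so
  -- the approach is empty.
  have hneg : ∀ {c : ℕ → ℕ}, InfinitelyManyTurns c → HasQuotients c (-α') →
      ApproachIs a h b [] ∧ NegDescribes a h b c α' := fun hc hqc =>
    ⟨R.approachIs_nil hpos (neg_pos.1 hqc.pos), R.symm.negDescribes hc hqc⟩
  refine ⟨R.describes hinf hq, R.riverIs hper0 hper hβ hβ' hαβ hαβ' hfix hfix', ?_, ?_, ?_, ?_⟩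
  · rintro as bs cs x y c rfl rfl hyx hcs
    have hmem : ∀ z ∈ cs ++ [c], 1 ≤ z := by
      intro z hz
      rw [← hcs] at hz
      exact hper z (by simpa [or_comm] using hz)
    have hinf' : InfinitelyManyTurns
        (periodicSeq (as ++ [x - y - 1, 1, c - 1]) (cs.reverse ++ [c])) :=
      infinitelyManyTurns_periodicSeq _ (by simp) fun z hz => hmem z (by simpa using hz)
    have hq' := hasQuotients_of_gt (hmem c (by simp)) hyx hcs hαβ' hrev
    exact ⟨R.approachIs_of_expansions (by omega) hinf hinf' hq hq', R.symm.describes hinf' hq'⟩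
  · rintro as bs w x y rfl hbs hxy
    rw [hbs] at hrev
    refine ⟨fun hw => ?_, ?_⟩
    · have hinf' := hreverse (as ++ [w - 1, 1, y - x - 1]) bs y hbs
      have hq' := hasQuotients_of_lt hxy hw hαβ' hrev
      exact ⟨R.approachIs_of_expansions (by omega) hinf hinf' hq hq', R.symm.describes hinf' hq'⟩
    · rintro rfl
      -- Only the first entry of the preperiod may be 0, so a vanishing `w` is that entry.
      have has : as = [] := by
        cases as with
        | nil => rfl
        | cons z as =>
          have := htail 0 (by simp)
          omega
      subst has
      have hq' : HasQuotients (periodicSeq [0, y - x] (bs.reverse ++ [y])) (-α') := by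
        have := hasQuotients_zero_cons (hasQuotients_neg_of_lt hxy.le hrev)
        rw [hαβ']
        simpa using this
      have hα'neg := neg_pos.1 hq'.pos
      refine ⟨rfl, ?_, hneg (hreverse _ bs y hbs) hq'⟩
      have ha : (0 : ℝ) < (a : ℝ) ^ 2 := by
        have : (a : ℝ) ≠ 0 := by exact_mod_cast R.lead
        positivity
      have hab : ((a * b : ℤ) : ℝ) < 0 := by
        rw [Int.cast_mul, R.prod, show (a : ℝ) * (a * (α * α')) = a ^ 2 * (α * α') by ring]
        exact mul_neg_of_pos_of_neg ha (mul_neg_of_pos_of_neg hpos hα'neg)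
      exact_mod_cast hab
  · rintro bs x y rfl hbs hxy
    rw [hbs] at hrev
    refine hneg (hreverse _ bs y hbs) ?_
    rw [hαβ']
    exact hasQuotients_neg_of_lt hxy.le hrev
  · rintro rfl
    refine hneg (infinitelyManyTurns_periodicSeq _ (by simpa using hper0) fun z hz =>
      hper z (by simpa using hz)) ?_
    rw [hαβ']
    simpa using hasQuotients_zero_cons (pre := []) (ξ := 1 / β') hrev
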